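/- **Setting.** Let $(\Omega,\mu)$ be a standard Borel probability space carrying an outcome $Y\in\mathbb R$, a discrete treatment $A\in\mathcal A=\{0,\dots,d\}$, an outcome proxy $W\in\mathcal W$, a treatment proxy $Z\in\mathcal Z$ and an unobserved confounder $U\in\mathcal U$, such that $Y\perp Z\mid U,A$, $W\perp Z\mid U,A$ and $W\perp A\mid U$. Let $P$ be the law of the observed data $\mathcal O=(Y,A,W,Z)$, with $p(a)=P(A=a)$, and $\theta_{\rm ATE}(a)=\mathbb E\big[\mathbb E[Y\mid A=a,U]\big]$. Assume that $\mathbb E[Y^2]<\infty$ and that $Z$ is complete for $U$: for every $a\in\mathcal A$ and every $\ell$ on $\mathcal U$ that is square integrable given $A=a$, $\mathbb E[\ell(U)\mid Z,A=a]=0$ a.s. if and only if $\ell(U)=0$ a.s. An *outcome bridge function* for a law $Q$ of $\mathcal O$ is an $h\in L_2(q_{W,A})$ with $\mathbb E_Q[Y\mid Z,A]=\mathbb E_Q[h(W,A)\mid Z,A]$. A *treatment bridge function* is a $\varphi_0\in L_2(p_{Z,A})$ with $\mathbb E[\varphi_0(Z,a)\mid W,A=a]=\frac{p(W)p(a)}{p(W,a)}$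 for all $a\in\mathcal A$; here the law of $W$ is assumed to be absolutely continuous with respect to the measure $P(W\in\cdot,A=a)$ for every $a$, and the ratio is the density of $p(a)\,P(W\in\cdot)$ with respect to it. Fix $a\in\mathcal A$. The *semiparametric model* $\mathcal M$ consists of all laws $Q$ of $\mathcal O$ with $\mathbb E_Q[Y^2]<\infty$ that admit an outcome bridge function $h_Q$ (not necessarily unique) and at which $\theta(a;Q):=\mathbb E_Q[h_Q(W,a)]$ is well defined (the integral exists and does not depend on the choice of $h_Q$). A *smooth submodel* of $\mathcal M$ through $P$ is a family $(P_\epsilon)$ with $P_0=P$ and, for small $\epsilon$, $P_\epsilon\in\mathcal M$ and $P_\epsilon$ has a density $g_\epsilon$ with respect to $P$, such that $(g_\epsilon-1)/\epsilon\to s$ in $L_\infty(P)$ as $\epsilon\to0$ for a bounded function $s$, its *score* (for instance $g_\epsilon=1+\epsilon s$ with $s$ bounded and of mean zero). The *tangent space* is the closed linear span of the scores in $L_2(P)$. An *efficient influence function* of $\theta(a;\cdot)$ at $P$ is a $\psi\in L_2(P)$ with $\mathbb E[\psi]=0$ that lies in the tangent space and satisfies $\frac{d}{d\epsilon}\theta(a;P_\epsilon)|_{\epsilon=0}=\mathbb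 E[\psi s]$ (the derivative exists) for every smooth submodel. The *local efficiency bound* is the supremum over smooth submodels of the Cramér–Rao bounds $\big(\frac{d}{d\epsilon}\theta(a;P_\epsilon)|_{\epsilon=0}\big)^2/\mathbb E[s^2]$ (with $0/0=0$). **Theorem (Efficient influence function).** Suppose that the conditional expectation operators $T:L_2(p_{W,A})\to L_2(p_{Z,A})$, $T\ell=\mathbb E[\ell(W,A)\mid Z,A]$, and $T^*:L_2(p_{Z,A})\to L_2(p_{W,A})$, $T^*\ell=\mathbb E[\ell(Z,A)\mid W,A]$, are surjective, that $h_0$ is an outcome bridge function for $P$, that $\varphi_0$ is a treatment bridge function for $P$, and that $h_0(W,a)$ and $\varphi_0(Z,A)(Y-h_0(W,A))\mathbf 1[A=a]$ are square integrable. Then $\mathbb E[Y\mid A=a,U]$ is integrable, $P\in\mathcal M$ with $\theta(a;P)=\theta_{\rm ATE}(a)$, and $$\psi_{\rm ATE}(\mathcal O;a)=\varphi_0(Z,A)\,(Y-h_0(W,A))\,\frac{1}{p(A)}\,\mathbf 1[A=a]+h_0(W,a)-\theta_{\rm ATE}(a)$$ is the ($P$-a.s. unique) efficient influence function of $\theta(a;\cdot)$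 at $P$ in $\mathcal M$. The semiparametric local efficiency bound equals $\mathbb E[\psi_{\rm ATE}(\mathcal O;a)^2]$. -/

import Mathlib

open MeasureTheory ProbabilityTheory Filter Topology

noncomputable section

/-! ### Semiparametric efficiency theory at a law `P` in a model `M` -/

section Efficiency

variable {O : Type*} [MeasurableSpace O]

/-- `Q` is a smooth one-dimensional submodel of the model `M` through `P`, with (bounded) score `s`:
`Q 0 = P`, the laws `Q ε` belong to `M` for small `ε`, and they have densities `g ε` with respect
to `P` that are differentiable at `ε = 0`, uniformly up to null sets, with derivative `s`
(which is also the derivative of `log (g ε)` at `0`, because `g 0 = 1`).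
The tilted models `dQ ε / dP = 1 + ε s`, with `s` bounded and of mean zero, are of this form. -/
structure IsSmoothSubmodel (M : Set (Measure O)) (P : Measure O)
    (Q : ℝ → Measure O) (s : O → ℝ) : Prop where
  zero : Q 0 = P
  mem : ∀ᶠ ε in 𝓝 (0 : ℝ), Q ε ∈ M
  score_bdd : MemLp s ⊤ P
  density : ∃ g : ℝ → O → ℝ, (∀ ε, Measurable (g ε)) ∧
    (∀ᶠ ε in 𝓝 (0 : ℝ), Q ε = P.withDensity (fun o => ENNReal.ofReal (g ε o))) ∧
    Tendsto (fun ε : ℝ => eLpNorm (fun o => (g ε o - 1) / ε - s o) ⊤ P) (𝓝[≠] 0) (𝓝 0)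

/-- The tangent space of `M` at `P`: the closed linear span in `L²(P)` of the scores of the
smooth submodels of `M` through `P`. -/
def tangentSpace (M : Set (Measure O)) (P : Measure O) : Submodule ℝ (Lp ℝ 2 P) :=
  (Submodule.span ℝ {f : Lp ℝ 2 P | ∃ Q s, IsSmoothSubmodel M P Q s ∧ f =ᵐ[P] s}).topologicalClosure

/-- `ψ` is an efficient influence function of the functional `θ` at `P` in the model `M`: it is
square integrable with mean zero, it represents the derivative of `θ` along every smooth
submodel (in particular, `θ` is pathwise differentiable), and it lies in the tangent space. -/
structure IsEfficientInfluenceFunction (M : Set (Measure O)) (θ : Measure O → ℝ)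
    (P : Measure O) (ψ : O → ℝ) : Prop where
  mem_model : P ∈ M
  memLp : MemLp ψ 2 P
  mean_zero : ∫ o, ψ o ∂P = 0
  pathwise : ∀ Q s, IsSmoothSubmodel M P Q s →
    HasDerivAt (fun ε : ℝ => θ (Q ε)) (∫ o, ψ o * s o ∂P) 0
  mem_tangent : memLp.toLp ψ ∈ tangentSpace M P

/-- `V` is the local efficiency bound for `θ` at `P` in `M`: the supremum of the Cramér-Rao bounds
`(d/dε θ(Q ε) at ε = 0)² / E[s²]` over the smooth submodels of `M` through `P`.
(For a submodel with `s = 0` a.s. the quotient is read as `0`.) -/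
def IsEfficiencyBound (M : Set (Measure O)) (θ : Measure O → ℝ) (P : Measure O) (V : ℝ) : Prop :=
  IsLUB {v : ℝ | ∃ Q s D, IsSmoothSubmodel M P Q s ∧
    HasDerivAt (fun ε : ℝ => θ (Q ε)) D 0 ∧ v = D ^ 2 / ∫ o, s o ^ 2 ∂P} V

end Efficiency

/-! ### The observed data `(Y, A, W, Z)`, with treatment levels `0, …, d` -/

section Observed

variable {d : ℕ} {𝒲 𝒵 : Type*} [MeasurableSpace 𝒲] [MeasurableSpace 𝒵]

/-- Values of the observed data `(Y, A, W, Z)`. -/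
abbrev Obs (d : ℕ) (𝒲 𝒵 : Type*) : Type _ := ℝ × Fin (d + 1) × 𝒲 × 𝒵

/-- The outcome `Y`. -/
def obsY (o : Obs d 𝒲 𝒵) : ℝ := o.1
/-- The treatment `A`. -/
def obsA (o : Obs d 𝒲 𝒵) : Fin (d + 1) := o.2.1
/-- The outcome proxy `W`. -/
def obsW (o : Obs d 𝒲 𝒵) : 𝒲 := o.2.2.1
/-- The treatment proxy `Z`. -/
def obsZ (o : Obs d 𝒲 𝒵) : 𝒵 := o.2.2.2
/-- The pair `(W, A)`. -/
def obsWA (o : Obs d 𝒲 𝒵) : 𝒲 × Fin (d + 1) := (obsW o, obsA o)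
/-- The pair `(Z, A)`. -/
def obsZA (o : Obs d 𝒲 𝒵) : 𝒵 × Fin (d + 1) := (obsZ o, obsA o)

/-- The conditional expectation operator `L²(p_X) → L²(p_X')`, `ℓ ↦ E[ℓ(X) | X']`, is surjective:
each `g ∈ L²(p_X')` is the image of some `ℓ ∈ L²(p_X)`. -/
def CondExpSurjective {O E F : Type*} [MeasurableSpace O] [mE : MeasurableSpace E]
    [mF : MeasurableSpace F] (Q : Measure O) (X : O → E) (X' : O → F) : Prop :=
  ∀ g : F → ℝ, MemLp g 2 (Q.map X') →
    ∃ l : E → ℝ, MemLp l 2 (Q.map X) ∧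
      Q[fun o => l (X o) | mF.comap X'] =ᵐ[Q] fun o => g (X' o)

/-- `h` is an outcome bridge function for the law `Q`: `h ∈ L²(p_{W,A})` and
`E[Y | Z, A] = E[h(W, A) | Z, A]`. -/
structure IsOutcomeBridge (Q : Measure (Obs d 𝒲 𝒵)) (h : 𝒲 → Fin (d + 1) → ℝ) : Prop where
  memLp : MemLp (fun x : 𝒲 × Fin (d + 1) => h x.1 x.2) 2 (Q.map obsWA)
  bridge : Q[obsY | MeasurableSpace.comap obsZA inferInstance] =ᵐ[Q]
    Q[fun o => h (obsW o) (obsA o) | MeasurableSpace.comap obsZA inferInstance]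

/-- The joint law of `(W, A)` at treatment level `a`, i.e. the measure `P(W ∈ ·, A = a)` on `𝒲`. -/
def jointW (Q : Measure (Obs d 𝒲 𝒵)) (a : Fin (d + 1)) : Measure 𝒲 :=
  (Q.restrict (obsA ⁻¹' {a})).map obsW

/-- The probability `p(a)` of the treatment level `a`. -/
def pA (Q : Measure (Obs d 𝒲 𝒵)) (a : Fin (d + 1)) : ℝ := Q.real (obsA ⁻¹' {a})

/-- The density ratio `p(w) p(a) / p(w, a)`. -/
def densityRatio (Q : Measure (Obs d 𝒲 𝒵)) (a : Fin (d + 1)) (w : 𝒲) : ℝ :=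
  ((Q (obsA ⁻¹' {a}) • Q.map obsW).rnDeriv (jointW Q a) w).toReal

/-- `φ` is a treatment bridge function for the law `Q`: `φ ∈ L²(p_{Z,A})` and, for each treatment
level `a`, `E[φ(Z, a) | W, A = a] = p(W) p(a) / p(W, a)`. The denominator must not vanish on a set
of positive `p_W`-measure (`overlap`). -/
structure IsTreatmentBridge (Q : Measure (Obs d 𝒲 𝒵)) (φ : 𝒵 → Fin (d + 1) → ℝ) : Prop where
  memLp : MemLp (fun x : 𝒵 × Fin (d + 1) => φ x.1 x.2) 2 (Q.map obsZA)
  overlap : ∀ a, Q.map obsW ≪ jointW Q a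
  bridge : ∀ a, (Q[|obsA ⁻¹' {a}])[fun o => φ (obsZ o) a |
      MeasurableSpace.comap obsW inferInstance] =ᵐ[Q[|obsA ⁻¹' {a}]]
    fun o => densityRatio Q a (obsW o)

/-- `t` is the value at `Q` of the functional `E_Q[h_Q(W, a)]`, with `h_Q` an outcome bridge function
for `Q`: a bridge function exists, and all of them give the value `t`. -/
def IsBridgeValue (a : Fin (d + 1)) (Q : Measure (Obs d 𝒲 𝒵)) (t : ℝ) : Prop :=
  (∃ h, IsOutcomeBridge Q h) ∧
  ∀ h, IsOutcomeBridge Q h →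
    Integrable (fun o => h (obsW o) a) Q ∧ ∫ o, h (obsW o) a ∂Q = t

/-- The semiparametric model: the laws of `(Y, A, W, Z)` with `Y` square integrable that admit an
outcome bridge function (not necessarily unique) and at which `E_Q[h_Q(W, a)]` is well defined. -/
def bridgeModel (d : ℕ) (𝒲 𝒵 : Type*) [MeasurableSpace 𝒲] [MeasurableSpace 𝒵]
    (a : Fin (d + 1)) : Set (Measure (Obs d 𝒲 𝒵)) :=
  {Q | IsProbabilityMeasure Q ∧ MemLp obsY 2 Q ∧ ∃ t, IsBridgeValue a Q t}

theorem IsBridgeValue.unique {a : Fin (d + 1)} {Q : Measure (Obs d 𝒲 𝒵)} {t t' : ℝ}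
    (ht : IsBridgeValue a Q t) (ht' : IsBridgeValue a Q t') : t = t' := by
  obtain ⟨h, hh⟩ := ht.1
  rw [← (ht.2 h hh).2, (ht'.2 h hh).2]

open Classical in
/-- The dose-response at `a` as a functional of the observed data law,
`θ(a; Q) = E_Q[h_Q(W, a)]` (and `0` off the model). -/
def doseResponseFunctional (a : Fin (d + 1)) (Q : Measure (Obs d 𝒲 𝒵)) : ℝ :=
  if h : ∃ t, IsBridgeValue a Q t then h.choose else 0

theorem doseResponseFunctional_eq {a : Fin (d + 1)} {Q : Measure (Obs d 𝒲 𝒵)} {t : ℝ}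
    (ht : IsBridgeValue a Q t) : doseResponseFunctional a Q = t := by
  have h : ∃ t, IsBridgeValue a Q t := ⟨t, ht⟩
  rw [doseResponseFunctional, dif_pos h]
  exact h.choose_spec.unique ht

/-- The function
`φ₀(Z, A) (Y - h₀(W, A)) 1[A = a] / p(A) + h₀(W, a) - θ` of the observed data `o = (Y, A, W, Z)`,
with `p` the law of `A` under `Q`. -/
def psiATE (Q : Measure (Obs d 𝒲 𝒵)) (h₀ : 𝒲 → Fin (d + 1) → ℝ) (φ₀ : 𝒵 → Fin (d + 1) → ℝ)
    (θ : ℝ) (a : Fin (d + 1)) (o : Obs d 𝒲 𝒵) : ℝ :=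
  φ₀ (obsZ o) (obsA o) * (obsY o - h₀ (obsW o) (obsA o)) * (1 / pA Q (obsA o)) *
      (if obsA o = a then 1 else 0)
    + h₀ (obsW o) a - θ

end Observed

/-! ### The causal model with unobserved confounder `U` -/

section Causal

variable {d : ℕ} {Ω 𝒲 𝒵 𝒰 : Type*} [MeasurableSpace Ω] [MeasurableSpace 𝒲] [MeasurableSpace 𝒵]
  [MeasurableSpace 𝒰]

/-- A version of `E[Y | A = a, U]`, as a `σ(U)`-measurable function on the probability space. -/
def outcomeRegression (μ : Measure Ω) (Y : Ω → ℝ) (A : Ω → Fin (d + 1)) (U : Ω → 𝒰)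
    (a : Fin (d + 1)) : Ω → ℝ :=
  (μ[|A ⁻¹' {a}])[Y | MeasurableSpace.comap U inferInstance]

/-- The dose-response `θ_ATE(a) = E[E[Y | A = a, U]]`. -/
def thetaATE (μ : Measure Ω) (Y : Ω → ℝ) (A : Ω → Fin (d + 1)) (U : Ω → 𝒰)
    (a : Fin (d + 1)) : ℝ :=
  ∫ ω, outcomeRegression μ Y A U a ω ∂μ

/-- The proxy model: `Y ⊥ Z | U, A`, `W ⊥ Z | U, A` and `W ⊥ A | U`. -/
structure IsProxyModel [StandardBorelSpace Ω] (μ : Measure Ω) [IsFiniteMeasure μ] (Y : Ω → ℝ)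
    (A : Ω → Fin (d + 1)) (W : Ω → 𝒲) (Z : Ω → 𝒵) (U : Ω → 𝒰) : Prop where
  measurable_Y : Measurable Y
  measurable_A : Measurable A
  measurable_W : Measurable W
  measurable_Z : Measurable Z
  measurable_U : Measurable U
  indep_Y_Z : CondIndepFun (MeasurableSpace.comap (fun ω => (U ω, A ω)) inferInstance)
    (measurable_U.prodMk measurable_A).comap_le Y Z μ
  indep_W_Z : CondIndepFun (MeasurableSpace.comap (fun ω => (U ω, A ω)) inferInstance)
    (measurable_U.prodMk measurable_A).comap_le W Z μ
  indep_W_A : CondIndepFun (MeasurableSpace.comap U inferInstance)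
    measurable_U.comap_le W A μ

/-- Completeness of the treatment proxy `Z` for `U`: for each level `a` and each `ℓ` on `𝒰` that is
square integrable given `A = a`, `E[ℓ(U) | Z, A = a] = 0` a.s. if and only if `ℓ(U) = 0` a.s. -/
def IsProxyComplete (μ : Measure Ω) (A : Ω → Fin (d + 1)) (Z : Ω → 𝒵) (U : Ω → 𝒰) : Prop :=
  ∀ (a : Fin (d + 1)) (l : 𝒰 → ℝ), Measurable l →
    MemLp (fun ω => l (U ω)) 2 (μ[|A ⁻¹' {a}]) →
    ((μ[|A ⁻¹' {a}])[fun ω => l (U ω) | MeasurableSpace.comap Z inferInstance]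
        =ᵐ[μ[|A ⁻¹' {a}]] 0 ↔
      (fun ω => l (U ω)) =ᵐ[μ] 0)

/-- The law of the observed data `(Y, A, W, Z)`. -/
def observedLaw (μ : Measure Ω) (Y : Ω → ℝ) (A : Ω → Fin (d + 1)) (W : Ω → 𝒲) (Z : Ω → 𝒵) :
    Measure (Obs d 𝒲 𝒵) :=
  μ.map (fun ω => (Y ω, A ω, W ω, Z ω))

end Causal

end

/-! Write `T` for `E[· | Z, A]` acting on square integrable functions of `(W, A)`. Its adjoint is
`E[· | W, A]`, so surjectivity of both makes `T` bijective, and the open mapping theorem gives a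
bounded inverse. This is used twice. First, invertibility survives small perturbations: for bounded
`s` the equation `E[(1 + ε s)(Y - f(W, A)) | Z, A] = 0` is solvable for small `ε`
(`CondExpSurjective.eventually_exists_condExp_eq_zero`). Hence every bounded `s` of mean zero is a
score, and the tangent space contains all mean-zero functions in `L²(P)`: the model is locally
nonparametric. Second, `T` is bounded below, so a bridge function `h` for a law whose density `g`
satisfies `|g - 1| ≤ δ` is within `O(δ)` of `h₀` in `L²` (`lpNorm_le_of_condExp_mul_eq_zero`).

The treatment bridge supplies the Riesz representer `q = φ₀(Z, A) 1[A = a] / p(A)` of `k ↦ E[k(W,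
a)]` on functions `k` of `(W, A)` (`IsTreatmentBridge.integrable_and_integral_eq`). Since `q`
depends on `(Z, A)` only, the bridge equations give `E[q (Y - h₀)] = 0` and `E[g q (Y - h)] = 0`,
whence the exact identity `θ(Q) - θ(P) = E[(g - 1)(h(W, a) + q (Y - h(W, A)))]`
(`integral_bridge_sub_integral_bridge`). Dividing by `ε` and replacing `h` by `h₀`, at a cost
`O(ε)`, yields the derivative `E[s (h₀(W, a) + q (Y - h₀))]`; no differentiability of the bridge
functions themselves is needed. Scores have mean zero, so subtracting `θ_ATE` changes nothing.

For identification, conditional independence of `Z` from `Y` and from `W` turns the bridge equation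
at `A = a` into a statement about `E[Y - h(W, a) | U, A = a]`, and completeness forces this function
of `U` to vanish. As `W ⊥ A | U`, it follows that `E[Y | U, A = a] = E[h(W, a) | U]`, first given `A
= a` and then, by completeness again, under `μ`. Integration gives `θ_ATE`.

Finally, two efficient influence functions differ by an element of the tangent space orthogonal to
every score, hence by zero; the efficiency bound is Cauchy-Schwarz, attained in the limit by bounded
scores approximating the influence function. -/

noncomputable section

/-! ### Conditional expectation and conditional independence -/

section ConditionalExpectation

variable {α : Type*} {m m0 : MeasurableSpace α} {μ : Measure α}

/-- Conditional moment equations become families of set integrals, a form in which changing or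
restricting the measure is a mere change of integrand or domain. -/
theorem condExp_ae_eq_zero_iff [IsFiniteMeasure μ] (hm : m ≤ m0) {f : α → ℝ} (hf : Integrable f μ) :
    μ[f | m] =ᵐ[μ] 0 ↔ ∀ s, MeasurableSet[m] s → ∫ x in s, f x ∂μ = 0 := by
  constructor
  · intro h s hs
    rw [← setIntegral_condExp hm hf hs, setIntegral_congr_ae (hm s hs) (h.mono fun x hx _ => hx)]
    simp
  · intro h
    refine (ae_eq_condExp_of_forall_setIntegral_eq hm hf (g := 0) ?_ ?_ ?_).symm
    · intro s _ _
      exact integrableOn_zero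
    · intro s hs _
      simp [h s hs]
    · exact aestronglyMeasurable_zero

theorem integral_mul_condExp [IsFiniteMeasure μ] (hm : m ≤ m0) {f g : α → ℝ}
    (hg : AEStronglyMeasurable[m] g μ)
    (hf : Integrable f μ) (hgf : Integrable (fun x => g x * f x) μ) :
    ∫ x, g x * (μ[f | m]) x ∂μ = ∫ x, g x * f x ∂μ := by
  rw [← integral_condExp hm (f := fun x => g x * f x)]
  exact integral_congr_ae (condExp_mul_of_aestronglyMeasurable_left hg hgf hf).symm

theorem integrable_mul_condExp {f g : α → ℝ} (hg : AEStronglyMeasurable[m] g μ)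
    (hf : Integrable f μ) (hgf : Integrable (fun x => g x * f x) μ) :
    Integrable (fun x => g x * (μ[f | m]) x) μ :=
  (integrable_condExp (m := m) (f := fun x => g x * f x)).congr
    (condExp_mul_of_aestronglyMeasurable_left hg hgf hf)

theorem condExp_indicator_mem_Icc [IsFiniteMeasure μ] (s : Set α) (hs : MeasurableSet s) :
    ∀ᵐ x ∂μ, (μ⟦s | m⟧) x ∈ Set.Icc (0 : ℝ) 1 := by
  by_cases hm : m ≤ m0
  · have h0 : 0 ≤ᵐ[μ] μ⟦s | m⟧ :=
      condExp_nonneg (ae_of_all _ fun x => Set.indicator_nonneg (fun _ _ => zero_le_one) x)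
    have h1 : μ⟦s | m⟧ ≤ᵐ[μ] μ[fun _ => (1 : ℝ) | m] :=
      condExp_mono ((integrable_const 1).indicator hs) (integrable_const 1)
        (ae_of_all _ fun x => Set.indicator_le_self' (fun _ _ => zero_le_one) x)
    rw [condExp_const hm] at h1
    filter_upwards [h0, h1] with x hx hx' using ⟨hx, hx'⟩
  · rw [condExp_of_not_le hm]
    simp

theorem aestronglyMeasurable_condExp_indicator (hm : m ≤ m0) (s : Set α) :
    AEStronglyMeasurable (μ⟦s | m⟧) μ :=
  (stronglyMeasurable_condExp.mono hm).aestronglyMeasurable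

theorem integrable_condExp_indicator_mul [IsFiniteMeasure μ] (hm : m ≤ m0) {s : Set α}
    (hs : MeasurableSet s) {f : α → ℝ} (hf : Integrable f μ) :
    Integrable (fun x => (μ⟦s | m⟧) x * f x) μ := by
  refine hf.bdd_mul (c := 1) (aestronglyMeasurable_condExp_indicator hm s) ?_
  filter_upwards [condExp_indicator_mem_Icc (m := m) s hs] with x hx
  rw [Real.norm_eq_abs, abs_of_nonneg hx.1]
  exact hx.2

end ConditionalExpectation

/-- Under conditional independence of `X` and `V` given `m'`, the event `V ∈ B` may be replaced by
its conditional probability in integrals of functions of `X` over events of `m'`. -/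
theorem CondIndepFun.setIntegral_inter_preimage {Ω E F : Type*} {m' : MeasurableSpace Ω}
    [mΩ : MeasurableSpace Ω] [StandardBorelSpace Ω] [mE : MeasurableSpace E] [MeasurableSpace F]
    {hm' : m' ≤ mΩ} {μ : Measure Ω} [IsFiniteMeasure μ] {X : Ω → E} {V : Ω → F}
    (h : CondIndepFun m' hm' X V μ) (hX : Measurable X) (hV : Measurable V) {f : Ω → ℝ}
    (hf : Integrable f μ) (hfX : AEStronglyMeasurable[mE.comap X] f μ) {B : Set F}
    (hB : MeasurableSet B) {C : Set Ω} (hC : MeasurableSet[m'] C) :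
    ∫ x in C ∩ V ⁻¹' B, f x ∂μ = ∫ x in C, (μ⟦V ⁻¹' B | m'⟧) x * f x ∂μ := by
  have hVB : MeasurableSet (V ⁻¹' B) := hV hB
  have hCm := hm' C hC
  set p := μ⟦V ⁻¹' B | m'⟧
  -- `D` is the error made on `C` by replacing the event with its conditional probability. It
  -- suffices that `E[D | X] = 0`: multiplying by `f`, a function of `X`, then handles every
  -- integrable `f` at once.
  let D : Ω → ℝ := C.indicator fun x => (V ⁻¹' B).indicator (fun _ => 1) x - p x
  have hD1 : Integrable (fun x => (V ⁻¹' B).indicator (fun _ => (1 : ℝ)) x - p x) μ :=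
    ((integrable_const 1).indicator hVB).sub integrable_condExp
  have hDint : Integrable D μ := hD1.indicator hCm
  have hfp : Integrable (fun x => p x * f x) μ := integrable_condExp_indicator_mul hm' hVB hf
  have hfB : Integrable ((V ⁻¹' B).indicator f) μ := hf.indicator hVB
  have hDf : (fun x => f x * D x) = C.indicator fun x => (V ⁻¹' B).indicator f x - p x * f x := by
    ext x
    by_cases hx : x ∈ C <;> by_cases hx' : x ∈ V ⁻¹' B <;> simp [D, hx, hx'] <;> ring
  have hDfint : Integrable (fun x => f x * D x) μ := by
    rw [hDf]
    exact (hfB.sub hfp).indicator hCm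
  have hcond : μ[D | mE.comap X] =ᵐ[μ] 0 := by
    rw [condExp_ae_eq_zero_iff hX.comap_le hDint]
    rintro _ ⟨S, hS, rfl⟩
    have hXS : MeasurableSet (X ⁻¹' S) := hX hS
    have hmul := (condIndepFun_iff_condExp_inter_preimage_eq_mul hX hV).1 h S B hS hB
    have hpS : Integrable (fun x => p x * (X ⁻¹' S).indicator (fun _ => (1 : ℝ)) x) μ :=
      integrable_condExp_indicator_mul hm' hVB ((integrable_const (1 : ℝ)).indicator hXS)
    have e1 : ∫ x in C, (X ⁻¹' S ∩ V ⁻¹' B).indicator (fun _ => (1 : ℝ)) x ∂μ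
        = ∫ x in C, p x * (X ⁻¹' S).indicator (fun _ => (1 : ℝ)) x ∂μ := by
      rw [← setIntegral_condExp hm' ((integrable_const (1 : ℝ)).indicator (hXS.inter hVB)) hC,
        ← setIntegral_condExp hm' hpS hC]
      refine setIntegral_congr_ae hCm ?_
      filter_upwards [hmul, condExp_mul_of_stronglyMeasurable_left (μ := μ)
        (stronglyMeasurable_condExp (m := m') (f := (V ⁻¹' B).indicator fun _ => (1 : ℝ))) hpS
        ((integrable_const (1 : ℝ)).indicator hXS)] with x hx hx' _
      rw [hx]
      refine Eq.trans ?_ hx'.symm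
      simp only [Pi.mul_apply]
      ring
    rw [← integral_indicator hCm, ← integral_indicator hCm, ← sub_eq_zero, ← integral_sub
      (((integrable_const (1 : ℝ)).indicator (hXS.inter hVB)).indicator hCm)
      (hpS.indicator hCm)] at e1
    rw [← integral_indicator hXS, ← e1]
    congr 1
    ext x
    by_cases hx : x ∈ C <;> by_cases hx' : x ∈ V ⁻¹' B <;> by_cases hx'' : x ∈ X ⁻¹' S <;>
      simp_all [D]
  have key : ∫ x, f x * D x ∂μ = 0 := by
    rw [← integral_mul_condExp hX.comap_le hfX hDint hDfint]
    rw [integral_congr_ae (g := fun _ => (0 : ℝ))]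
    · simp
    · filter_upwards [hcond] with x hx
      simp [hx]
  rw [hDf, integral_indicator hCm, integral_sub hfB.integrableOn hfp.integrableOn,
    setIntegral_indicator hVB, sub_eq_zero] at key
  exact key

/-! ### The treatment bridge as a Riesz representer -/

section Observables

variable {d : ℕ} {𝒲 𝒵 : Type*} [MeasurableSpace 𝒲] [MeasurableSpace 𝒵]

theorem measurable_obsA : Measurable (obsA : Obs d 𝒲 𝒵 → Fin (d + 1)) :=
  measurable_fst.comp measurable_snd

theorem measurable_obsW : Measurable (obsW : Obs d 𝒲 𝒵 → 𝒲) :=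
  measurable_fst.comp (measurable_snd.comp measurable_snd)

theorem measurable_obsZ : Measurable (obsZ : Obs d 𝒲 𝒵 → 𝒵) :=
  measurable_snd.comp (measurable_snd.comp measurable_snd)

theorem measurable_obsWA : Measurable (obsWA : Obs d 𝒲 𝒵 → 𝒲 × Fin (d + 1)) :=
  measurable_obsW.prodMk measurable_obsA

theorem measurable_obsZA : Measurable (obsZA : Obs d 𝒲 𝒵 → 𝒵 × Fin (d + 1)) :=
  measurable_obsZ.prodMk measurable_obsA

theorem measurableSet_obsA_preimage (a : Fin (d + 1)) :
    MeasurableSet ((obsA : Obs d 𝒲 𝒵 → Fin (d + 1)) ⁻¹' {a}) :=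
  measurable_obsA (measurableSet_singleton a)

variable {P : Measure (Obs d 𝒲 𝒵)}

theorem memLp_map_obsWA_iff {k : 𝒲 → Fin (d + 1) → ℝ}
    (hk : AEStronglyMeasurable (fun x : 𝒲 × Fin (d + 1) => k x.1 x.2) (P.map obsWA)) :
    MemLp (fun x : 𝒲 × Fin (d + 1) => k x.1 x.2) 2 (P.map obsWA) ↔
      MemLp (fun o => k (obsW o) (obsA o)) 2 P :=
  memLp_map_measure_iff hk measurable_obsWA.aemeasurable

theorem memLp_obsWA {k : 𝒲 → Fin (d + 1) → ℝ}
    (hk : MemLp (fun x : 𝒲 × Fin (d + 1) => k x.1 x.2) 2 (P.map obsWA)) :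
    MemLp (fun o => k (obsW o) (obsA o)) 2 P :=
  (memLp_map_obsWA_iff hk.1).1 hk

theorem memLp_obsZA {k : 𝒵 → Fin (d + 1) → ℝ}
    (hk : MemLp (fun x : 𝒵 × Fin (d + 1) => k x.1 x.2) 2 (P.map obsZA)) :
    MemLp (fun o => k (obsZ o) (obsA o)) 2 P :=
  (memLp_map_measure_iff hk.1 measurable_obsZA.aemeasurable).1 hk

/-- A function of `(W, A)` is only controlled up to null sets of the joint law. On `A = a` the pair
`(W, A)` is `(W, a)`, so the image of `jointW P a` in the slice at `a` is dominated by that law and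
the section inherits measurability. -/
theorem aestronglyMeasurable_section {k : 𝒲 → Fin (d + 1) → ℝ}
    (hk : AEStronglyMeasurable (fun x : 𝒲 × Fin (d + 1) => k x.1 x.2) (P.map obsWA))
    (a : Fin (d + 1)) : AEStronglyMeasurable (fun w => k w a) (jointW P a) := by
  have hsec : Measurable (fun w : 𝒲 => (w, a)) := measurable_id.prodMk measurable_const
  have hmap : (jointW P a).map (fun w : 𝒲 => (w, a)) ≪ P.map obsWA := by
    rw [jointW, Measure.map_map hsec measurable_obsW]
    have : (P.restrict (obsA ⁻¹' {a})).map ((fun w : 𝒲 => (w, a)) ∘ obsW)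
        = (P.restrict (obsA ⁻¹' {a})).map obsWA := by
      refine Measure.map_congr ?_
      refine (ae_restrict_iff' (measurableSet_obsA_preimage a)).2 (ae_of_all _ fun o ho => ?_)
      have ho' : obsA o = a := ho
      simp [obsWA, ho']
    rw [this]
    exact Measure.absolutelyContinuous_of_le Measure.restrict_le_self |>.map measurable_obsWA
  exact (hk.mono_ac hmap).comp_measurable hsec

theorem pA_ne_zero_of_ac [IsProbabilityMeasure P] {a : Fin (d + 1)}
    (h : P.map obsW ≪ jointW P a) : P (obsA ⁻¹' {a}) ≠ 0 := by
  intro h0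
  have hz : jointW P a = 0 := by
    rw [jointW, Measure.restrict_eq_zero.2 h0, Measure.map_zero]
  rw [hz, Measure.absolutelyContinuous_zero_iff, Measure.map_eq_zero_iff
    measurable_obsW.aemeasurable] at h
  exact IsProbabilityMeasure.ne_zero P h

theorem pA_pos_of_ac [IsProbabilityMeasure P] {a : Fin (d + 1)}
    (h : P.map obsW ≪ jointW P a) : 0 < pA P a :=
  ENNReal.toReal_pos (pA_ne_zero_of_ac h) (measure_ne_top _ _)

/-- The function `φ(Z, A) 1[A = a] / p(A)`, which represents `k ↦ E[k(W, a)]` on `L²(p_{W,A})`. -/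
def bridgeWeight (P : Measure (Obs d 𝒲 𝒵)) (φ : 𝒵 → Fin (d + 1) → ℝ) (a : Fin (d + 1))
    (o : Obs d 𝒲 𝒵) : ℝ :=
  φ (obsZ o) (obsA o) * (1 / pA P (obsA o)) * (if obsA o = a then 1 else 0)

theorem bridgeWeight_eq_indicator (φ : 𝒵 → Fin (d + 1) → ℝ) (a : Fin (d + 1)) :
    bridgeWeight P φ a = (obsA ⁻¹' {a}).indicator
      (fun o => (pA P a)⁻¹ * φ (obsZ o) (obsA o)) := by
  ext o
  by_cases h : obsA o = a
  · simp [bridgeWeight, h, mul_comm]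
  · simp [bridgeWeight, h]

theorem IsTreatmentBridge.memLp_bridgeWeight {φ : 𝒵 → Fin (d + 1) → ℝ}
    (hφ : IsTreatmentBridge P φ) (a : Fin (d + 1)) : MemLp (bridgeWeight P φ a) 2 P := by
  rw [bridgeWeight_eq_indicator]
  exact ((memLp_obsZA hφ.memLp).const_mul _).indicator (measurableSet_obsA_preimage a)

theorem IsTreatmentBridge.aestronglyMeasurable_bridgeWeight {φ : 𝒵 → Fin (d + 1) → ℝ}
    (hφ : IsTreatmentBridge P φ) (a : Fin (d + 1)) :
    AEStronglyMeasurable[MeasurableSpace.comap obsZA inferInstance] (bridgeWeight P φ a) P := by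
  have h1 : AEStronglyMeasurable (fun x : 𝒵 × Fin (d + 1) =>
      φ x.1 x.2 * (1 / pA P x.2) * (if x.2 = a then 1 else 0)) (P.map obsZA) := by
    refine (hφ.memLp.1.mul ?_).mul ?_
    · exact ((measurable_of_finite fun i : Fin (d + 1) => 1 / pA P i).comp
        measurable_snd).aestronglyMeasurable
    · exact ((measurable_of_finite fun i : Fin (d + 1) => if i = a then (1 : ℝ) else 0).comp
        measurable_snd).aestronglyMeasurable
  exact h1.comp_ae_measurable' measurable_obsZA.aemeasurable

/-- A treatment bridge function represents `k ↦ E[k(W, a)]` on `L²(p_{W,A})`. -/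
theorem IsTreatmentBridge.integrable_and_integral_eq [IsProbabilityMeasure P]
    {φ : 𝒵 → Fin (d + 1) → ℝ}
    (hφ : IsTreatmentBridge P φ) {k : 𝒲 → Fin (d + 1) → ℝ}
    (hk : MemLp (fun x : 𝒲 × Fin (d + 1) => k x.1 x.2) 2 (P.map obsWA)) (a : Fin (d + 1)) :
    Integrable (fun o => k (obsW o) a) P ∧
      ∫ o, k (obsW o) a ∂P = ∫ o, bridgeWeight P φ a o * k (obsW o) (obsA o) ∂P := by
  set S : Set (Obs d 𝒲 𝒵) := obsA ⁻¹' {a} with hSdef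
  have hS : MeasurableSet S := measurableSet_obsA_preimage a
  have hac := hφ.overlap a
  have hc0 : P S ≠ 0 := pA_ne_zero_of_ac hac
  have hpos : 0 < pA P a := pA_pos_of_ac hac
  have hsec := aestronglyMeasurable_section hk.1 a
  have hsecP : AEStronglyMeasurable (fun w => k w a) (P.map obsW) := hsec.mono_ac hac
  have hac' : P S • P.map obsW ≪ jointW P a := (Measure.smul_absolutelyContinuous).trans hac
  have hfin : IsFiniteMeasure (jointW P a) := by unfold jointW; infer_instance
  have hfin' : IsFiniteMeasure (P S • P.map obsW) := by
    refine ⟨?_⟩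
    rw [Measure.smul_apply, smul_eq_mul]
    exact ENNReal.mul_lt_top (measure_lt_top _ _) (measure_lt_top _ _)
  have hcond : P[|S] = (P S)⁻¹ • P.restrict S := rfl
  have hνP : P[|S] ≪ P.restrict S := by
    rw [hcond]; exact Measure.smul_absolutelyContinuous
  have hPν : P.restrict S ≪ P[|S] := by
    rw [hcond]
    exact Measure.absolutelyContinuous_smul (ENNReal.inv_ne_zero.2 (measure_ne_top _ _))
  have hprob : IsProbabilityMeasure (P[|S]) := cond_isProbabilityMeasure hc0
  have hcinv : (P S)⁻¹ ≠ ⊤ := ENNReal.inv_ne_top.2 hc0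
  have hAa : ∀ᵐ o ∂P.restrict S, obsA o = a :=
    (ae_restrict_iff' hS).2 (ae_of_all _ fun o ho => ho)
  have hφν : MemLp (fun o => φ (obsZ o) a) 2 (P[|S]) := by
    rw [hcond]
    refine MemLp.smul_measure ?_ hcinv
    exact (memLp_congr_ae (hAa.mono fun o ho => by simp only [ho])).1
      ((memLp_obsZA hφ.memLp).restrict S)
  have hkν : MemLp (fun o => k (obsW o) a) 2 (P[|S]) := by
    rw [hcond]
    refine MemLp.smul_measure ?_ hcinv
    exact (memLp_congr_ae (hAa.mono fun o ho => by simp only [ho])).1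
      ((memLp_obsWA hk).restrict S)
  have hkW : AEStronglyMeasurable[MeasurableSpace.comap obsW inferInstance]
      (fun o => k (obsW o) a) (P[|S]) := by
    have : AEStronglyMeasurable[MeasurableSpace.comap obsW inferInstance]
      (fun o => k (obsW o) a) (P.restrict S) :=
      hsec.comp_ae_measurable' measurable_obsW.aemeasurable
    exact this.mono_ac hνP
  have hprod : Integrable (fun o => k (obsW o) a * φ (obsZ o) a) (P[|S]) :=
    hkν.integrable_mul hφν
  have hφint : Integrable (fun o => φ (obsZ o) a) (P[|S]) := hφν.integrable one_le_two
  -- Given `A = a`, `k(W, a)` is a function of `W`, so pairing it with `φ(Z, a)` is pairing it with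
  -- the density ratio.
  have hratio : ∀ᵐ o ∂P[|S], k (obsW o) a *
      ((P[|S])[fun o => φ (obsZ o) a | MeasurableSpace.comap obsW inferInstance]) o =
      densityRatio P a (obsW o) * k (obsW o) a := by
    filter_upwards [hφ.bridge a] with o ho
    rw [ho, mul_comm]
  have hdm : AEStronglyMeasurable (fun w => densityRatio P a w * k w a) (jointW P a) := by
    refine AEStronglyMeasurable.mul ?_ hsec
    exact (Measure.measurable_rnDeriv _ _).ennreal_toReal.aestronglyMeasurable
  have hint1 : Integrable (fun o => densityRatio P a (obsW o) * k (obsW o) a) (P[|S]) :=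
    (integrable_mul_condExp hkW hφint hprod).congr hratio
  have hint2 : Integrable (fun o => densityRatio P a (obsW o) * k (obsW o) a) (P.restrict S) := by
    rw [hcond, integrable_smul_measure (ENNReal.inv_ne_zero.2 (measure_ne_top _ _)) hcinv] at hint1
    exact hint1
  have hint3 : Integrable (fun w => densityRatio P a w * k w a) (jointW P a) :=
    (integrable_map_measure hdm measurable_obsW.aemeasurable).2 hint2
  -- By overlap the ratio is a true density of `p(a) P_W`. Integrability of the product `k φ` thus
  -- passes to `k(W, a)` under the marginal law of `W`, although `k` is a priori only square
  -- integrable under the law of `(W, A)`.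
  have hint4 : Integrable (fun w => k w a) (P S • P.map obsW) :=
    (integrable_rnDeriv_smul_iff hac').1 hint3
  have hint5 : Integrable (fun w => k w a) (P.map obsW) :=
    (integrable_smul_measure hc0 (measure_ne_top _ _)).1 hint4
  refine ⟨(integrable_map_measure hsecP measurable_obsW.aemeasurable).1 hint5, ?_⟩
  have e1 : ∫ w, densityRatio P a w * k w a ∂(jointW P a) = pA P a * ∫ o, k (obsW o) a ∂P := by
    have := integral_rnDeriv_smul hac' (f := fun w => k w a)
    rw [integral_smul_measure, integral_map measurable_obsW.aemeasurable hsecP] at this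
    exact this
  have e2 : ∫ w, densityRatio P a w * k w a ∂(jointW P a)
      = ∫ o in S, densityRatio P a (obsW o) * k (obsW o) a ∂P :=
    integral_map measurable_obsW.aemeasurable hdm
  have e3 : ∫ o in S, densityRatio P a (obsW o) * k (obsW o) a ∂P
      = ∫ o in S, k (obsW o) a * φ (obsZ o) a ∂P := by
    have h := integral_mul_condExp measurable_obsW.comap_le hkW hφint hprod
    rw [integral_congr_ae hratio, hcond, integral_smul_measure, integral_smul_measure] at h
    -- Both sides carry the same nonzero normalising factor `1 / P(A = a)`.
    exact smul_right_injective ℝ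
      (ENNReal.toReal_pos (ENNReal.inv_ne_zero.2 (measure_ne_top P S)) hcinv).ne' h
  have e4 : ∫ o, bridgeWeight P φ a o * k (obsW o) (obsA o) ∂P
      = (pA P a)⁻¹ * ∫ o in S, k (obsW o) a * φ (obsZ o) a ∂P := by
    rw [← integral_const_mul, ← integral_indicator hS]
    congr 1
    ext o
    rw [bridgeWeight_eq_indicator]
    by_cases ho : o ∈ S
    · have ho' : obsA o = a := ho
      rw [Set.indicator_of_mem ho, Set.indicator_of_mem ho, ho']
      ring
    · rw [Set.indicator_of_notMem ho, Set.indicator_of_notMem ho, zero_mul]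
  rw [e4, ← e3, ← e2, e1, inv_mul_cancel_left₀ hpos.ne']

/-- The pairing of two square integrable functions is bounded by the product of their norms. -/
theorem integral_mul_le_lpNorm_mul_lpNorm {α : Type*} [MeasurableSpace α] {μ : Measure α}
    {f g : α → ℝ} (hf : MemLp f 2 μ) (hg : MemLp g 2 μ) :
    |∫ x, f x * g x ∂μ| ≤ lpNorm f 2 μ * lpNorm g 2 μ := by
  have h := abs_real_inner_le_norm (hf.toLp f) (hg.toLp g)
  rw [L2.inner_def, Lp.norm_toLp, Lp.norm_toLp, toReal_eLpNorm hf.1, toReal_eLpNorm hg.1] at h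
  refine le_trans (le_of_eq ?_) h
  congr 1
  refine integral_congr_ae ?_
  filter_upwards [hf.coeFn_toLp, hg.coeFn_toLp] with x hx hx'
  rw [hx, hx']
  simp [mul_comm]

/-- The representation applied to `|k|`, followed by Cauchy-Schwarz. It controls the section at `a`
under the marginal law of `W`, where no `L²` bound is at hand. -/
theorem IsTreatmentBridge.integral_abs_le [IsProbabilityMeasure P]
    {φ : 𝒵 → Fin (d + 1) → ℝ}
    (hφ : IsTreatmentBridge P φ) {k : 𝒲 → Fin (d + 1) → ℝ}
    (hk : MemLp (fun x : 𝒲 × Fin (d + 1) => k x.1 x.2) 2 (P.map obsWA)) (a : Fin (d + 1)) :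
    ∫ o, |k (obsW o) a| ∂P ≤
      lpNorm (bridgeWeight P φ a) 2 P * lpNorm (fun o => k (obsW o) (obsA o)) 2 P := by
  have habs := (hφ.integrable_and_integral_eq (k := fun w a => |k w a|) hk.abs a).2
  rw [habs, ← lpNorm_fun_abs (memLp_obsWA hk).1]
  exact (le_abs_self _).trans
    (integral_mul_le_lpNorm_mul_lpNorm (hφ.memLp_bridgeWeight a) (memLp_obsWA hk).abs)

end Observables

theorem tendsto_add_smul_nhds_zero {E : Type*} [AddCommMonoid E] [Module ℝ E] [TopologicalSpace E]
    [ContinuousAdd E] [ContinuousSMul ℝ E] (x y : E) :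
    Tendsto (fun ε : ℝ => x + ε • y) (𝓝 0) (𝓝 x) := by
  have h : Continuous fun ε : ℝ => x + ε • y := by fun_prop
  simpa using h.tendsto 0

/-! ### Invertibility of the conditional expectation operator -/

section CondExpOperator

variable {O E F : Type*} {m : MeasurableSpace O} {n : MeasurableSpace O} [mO : MeasurableSpace O]
  [mE : MeasurableSpace E] [mF : MeasurableSpace F]
  {P : Measure O}

theorem exists_ae_eq_comp_of_aestronglyMeasurable_comap {X : O → E} {f : O → ℝ}
    (hf : AEStronglyMeasurable[mE.comap X] f P) :
    ∃ l : E → ℝ, StronglyMeasurable l ∧ f =ᵐ[P] fun o => l (X o) := by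
  obtain ⟨l, hl, hfl⟩ := hf.stronglyMeasurable_mk.exists_eq_measurable_comp
  exact ⟨l, hl, hf.ae_eq_mk.trans (by rw [hfl]; rfl)⟩

variable (n) in
/-- The conditional expectation given `m`, multiplied beforehand by the bounded function `s`,
as an operator on the square integrable `n`-measurable functions. -/
def condExpMulL2 (hm : m ≤ mO) (s : Lp ℝ ⊤ P) :
    lpMeas ℝ ℝ n 2 P →L[ℝ] lpMeas ℝ ℝ m 2 P :=
  (condExpL2 ℝ ℝ hm) ∘L ((ContinuousLinearMap.mul ℝ ℝ).holderL P ⊤ 2 2 s) ∘L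
    (lpMeas ℝ ℝ n 2 P).subtypeL

variable (n) in
/-- The conditional expectation given `m` as an operator on the square integrable `n`-measurable
functions. -/
def condExpOpL2 (hm : m ≤ mO) :
    lpMeas ℝ ℝ n 2 P →L[ℝ] lpMeas ℝ ℝ m 2 P :=
  (condExpL2 ℝ ℝ hm) ∘L (lpMeas ℝ ℝ n 2 P).subtypeL

/-- Each operator is an orthogonal projection restricted to the range of the other, so both sides
equal the inner product in the ambient `L²`. -/
theorem inner_condExpOpL2 (hm : m ≤ mO) (hn : n ≤ mO)
    (f : lpMeas ℝ ℝ n 2 P) (g : lpMeas ℝ ℝ m 2 P) :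
    inner ℝ (condExpOpL2 n hm f) g = inner ℝ f (condExpOpL2 m hn g) := by
  have : Fact (m ≤ mO) := ⟨hm⟩
  have : Fact (n ≤ mO) := ⟨hn⟩
  have h1 : inner ℝ (condExpOpL2 n hm f) g = inner ℝ (f : Lp ℝ 2 P) (g : Lp ℝ 2 P) :=
    Submodule.inner_orthogonalProjectionOnto_eq_of_mem_right g (f : Lp ℝ 2 P)
  have h2 : inner ℝ f (condExpOpL2 m hn g) = inner ℝ (f : Lp ℝ 2 P) (g : Lp ℝ 2 P) :=
    Submodule.inner_orthogonalProjectionOnto_eq_of_mem_left f (g : Lp ℝ 2 P)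
  rw [h1, h2]

variable [IsFiniteMeasure P]

theorem coe_condExpL2_ae_eq (hm : m ≤ mO) (f : Lp ℝ 2 P) :
    ((condExpL2 ℝ ℝ hm f : lpMeas ℝ ℝ m 2 P) : O → ℝ) =ᵐ[P] P[f | m] := by
  have h := (Lp.memLp f).condExpL2_ae_eq_condExp (𝕜 := ℝ) hm
  rwa [Lp.toLp_coeFn] at h

theorem CondExpSurjective.surjective_condExpOpL2 {X : O → E} {X' : O → F} (hX : Measurable X)
    (hX' : Measurable X') (h : CondExpSurjective P X X') :
    Function.Surjective (condExpOpL2 (P := P) (mE.comap X) hX'.comap_le) := by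
  intro g
  obtain ⟨g', hg', hgg'⟩ := exists_ae_eq_comp_of_aestronglyMeasurable_comap
    (lpMeas.aestronglyMeasurable g)
  have hg2 : MemLp g' 2 (P.map X') :=
    (memLp_map_measure_iff hg'.aestronglyMeasurable hX'.aemeasurable).2
      ((memLp_congr_ae hgg').1 (Lp.memLp (g : Lp ℝ 2 P)))
  obtain ⟨l, hl, hlg⟩ := h g' hg2
  have hl2 : MemLp (fun o => l (X o)) 2 P := (memLp_map_measure_iff hl.1 hX.aemeasurable).1 hl
  have hlX : AEStronglyMeasurable[mE.comap X] (fun o => l (X o)) P :=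
    hl.1.comp_ae_measurable' hX.aemeasurable
  refine ⟨⟨hl2.toLp _, mem_lpMeas_iff_aestronglyMeasurable.2
    (hlX.congr hl2.coeFn_toLp.symm)⟩, ?_⟩
  refine Subtype.ext (Lp.ext ?_)
  refine (coe_condExpL2_ae_eq hX'.comap_le _).trans ?_
  refine (condExp_congr_ae hl2.coeFn_toLp).trans ?_
  exact hlg.trans hgg'.symm

/-- The kernel of an operator is orthogonal to the range of its adjoint, which here is everything.
-/
theorem CondExpSurjective.injective_condExpOpL2 {X : O → E} {X' : O → F} (hX : Measurable X)
    (hX' : Measurable X') (h : CondExpSurjective P X' X) :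
    Function.Injective (condExpOpL2 (P := P) (mE.comap X) hX'.comap_le) := by
  rw [injective_iff_map_eq_zero]
  intro f hf
  obtain ⟨l, hl⟩ := h.surjective_condExpOpL2 hX' hX f
  have := inner_condExpOpL2 hX'.comap_le hX.comap_le f l
  rwa [hf, inner_zero_left, hl, eq_comm, inner_self_eq_zero] at this

/-- The conditional expectation operator as an isomorphism, when it and its adjoint are
surjective. -/
def condExpEquivL2 {X : O → E} {X' : O → F} (hX : Measurable X) (hX' : Measurable X')
    (h : CondExpSurjective P X X') (h' : CondExpSurjective P X' X) :
    lpMeas ℝ ℝ (mE.comap X) 2 P ≃L[ℝ] lpMeas ℝ ℝ (mF.comap X') 2 P :=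
  haveI : Fact (mE.comap X ≤ mO) := ⟨hX.comap_le⟩
  haveI : Fact (mF.comap X' ≤ mO) := ⟨hX'.comap_le⟩
  -- The open mapping theorem makes the inverse continuous; it needs the completeness provided by
  -- the two `Fact` instances.
  ContinuousLinearEquiv.ofBijective (condExpOpL2 (P := P) (mE.comap X) hX'.comap_le)
    (LinearMap.ker_eq_bot.2 (h'.injective_condExpOpL2 hX hX'))
    (LinearMap.range_eq_top.2 (h.surjective_condExpOpL2 hX hX'))

theorem coe_condExpEquivL2 {X : O → E} {X' : O → F} (hX : Measurable X) (hX' : Measurable X')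
    (h : CondExpSurjective P X X') (h' : CondExpSurjective P X' X) :
    (condExpEquivL2 hX hX' h h' : lpMeas ℝ ℝ (mE.comap X) 2 P →L[ℝ] lpMeas ℝ ℝ (mF.comap X') 2 P)
      = condExpOpL2 (mE.comap X) hX'.comap_le :=
  ContinuousLinearMap.ext fun _ => rfl

/-- If both conditional expectation operators are surjective, they are bounded below. -/
theorem CondExpSurjective.exists_lpNorm_le {X : O → E} {X' : O → F} (hX : Measurable X)
    (hX' : Measurable X') (h : CondExpSurjective P X X') (h' : CondExpSurjective P X' X) :
    ∃ C : ℝ, 0 ≤ C ∧ ∀ f : O → ℝ, MemLp f 2 P → AEStronglyMeasurable[mE.comap X] f P →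
      lpNorm f 2 P ≤ C * lpNorm (P[f | mF.comap X']) 2 P := by
  set e := condExpEquivL2 hX hX' h h'
  refine ⟨‖(e.symm : lpMeas ℝ ℝ (mF.comap X') 2 P →L[ℝ] lpMeas ℝ ℝ (mE.comap X) 2 P)‖,
    ContinuousLinearMap.opNorm_nonneg _, fun f hf hfX => ?_⟩
  let f' : lpMeas ℝ ℝ (mE.comap X) 2 P := ⟨hf.toLp f, mem_lpMeas_iff_aestronglyMeasurable.2
    (hfX.congr hf.coeFn_toLp.symm)⟩
  have h1 := (e.symm : lpMeas ℝ ℝ (mF.comap X') 2 P →L[ℝ] lpMeas ℝ ℝ (mE.comap X) 2 P).le_opNorm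
    (e f')
  have h2 : ‖f'‖ = lpNorm f 2 P := by
    rw [← toReal_eLpNorm hf.1, ← Lp.norm_toLp f hf]; rfl
  have h3 : ‖e f'‖ = lpNorm (P[f | mF.comap X']) 2 P := by
    have hc : MemLp (P[f | mF.comap X']) 2 P := hf.condExp one_le_two
    rw [← toReal_eLpNorm hc.1, ← Lp.norm_toLp _ hc]
    change ‖((e f' : lpMeas ℝ ℝ (mF.comap X') 2 P) : Lp ℝ 2 P)‖ = _
    congr 1
    refine Lp.ext ?_
    refine EventuallyEq.trans ?_ hc.coeFn_toLp.symm
    exact (coe_condExpL2_ae_eq hX'.comap_le _).trans (condExp_congr_ae hf.coeFn_toLp)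
  rw [h3] at h1
  simpa [h2] using h1

/-- The perturbed conditional moment equation `E[(1 + ε s)(y - f(X)) | X'] = 0` is solvable for small
`ε` if both conditional expectation operators are surjective. -/
theorem CondExpSurjective.eventually_exists_condExp_eq_zero {X : O → E} {X' : O → F}
    (hX : Measurable X) (hX' : Measurable X') (h : CondExpSurjective P X X')
    (h' : CondExpSurjective P X' X) {s : O → ℝ} (hs : MemLp s ⊤ P) :
    ∀ᶠ ε in 𝓝 (0 : ℝ), ∀ y : O → ℝ, MemLp y 2 P → ∃ f : O → ℝ, MemLp f 2 P ∧
      AEStronglyMeasurable[mE.comap X] f P ∧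
      P[fun o => (1 + ε * s o) * (y o - f o) | mF.comap X'] =ᵐ[P] 0 := by
  have : Fact (mE.comap X ≤ mO) := ⟨hX.comap_le⟩
  set e := condExpEquivL2 hX hX' h h'
  have hcont : Tendsto (fun ε : ℝ => condExpOpL2 (mE.comap X) hX'.comap_le +
      ε • condExpMulL2 (P := P) (mE.comap X) hX'.comap_le (hs.toLp s)) (𝓝 0)
      (𝓝 (condExpOpL2 (mE.comap X) hX'.comap_le)) :=
    tendsto_add_smul_nhds_zero _ _
  -- Invertible operators form a neighbourhood of `T`. The admissible `ε` thus depend on the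
  -- operator alone and not on the right-hand side `y`.
  have hnhds := e.nhds
  rw [coe_condExpEquivL2 hX hX' h h'] at hnhds
  filter_upwards [hcont hnhds] with ε hε y hy
  obtain ⟨e', he'⟩ := hε
  have hsy : ∀ z : O → ℝ, MemLp z 2 P → MemLp (fun o => (1 + ε * s o) * z o) 2 P := by
    intro z hz
    have := hz.add ((hz.mul (r := 2) hs).const_mul ε)
    refine (memLp_congr_ae (ae_of_all _ fun o => ?_)).1 this
    simp only [Pi.add_apply, Pi.mul_apply]
    ring
  -- The equation reads `E[(1 + ε s) f | X'] = E[(1 + ε s) y | X']`, whose left side is the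
  -- invertible perturbed operator at `f`.
  set f' := e'.symm (condExpL2 ℝ ℝ hX'.comap_le ((hsy y hy).toLp _)) with hf'
  have hf2 : MemLp ((f' : Lp ℝ 2 P) : O → ℝ) 2 P := Lp.memLp _
  refine ⟨f', hf2, lpMeas.aestronglyMeasurable f', ?_⟩
  have key : e' f' = condExpL2 ℝ ℝ hX'.comap_le ((hsy y hy).toLp _) := by simp [hf']
  have key2 : e' f' = condExpL2 ℝ ℝ hX'.comap_le ((hsy _ hf2).toLp _) := by
    change (e' : lpMeas ℝ ℝ (mE.comap X) 2 P →L[ℝ] lpMeas ℝ ℝ (mF.comap X') 2 P) f' = _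
    rw [he']
    change condExpL2 ℝ ℝ hX'.comap_le (f' : Lp ℝ 2 P) + ε • condExpL2 ℝ ℝ hX'.comap_le
      ((ContinuousLinearMap.mul ℝ ℝ).holderL P ⊤ 2 2 (hs.toLp s) (f' : Lp ℝ 2 P)) = _
    rw [← map_smul, ← map_add]
    congr 1
    refine Lp.ext ?_
    refine EventuallyEq.trans ?_ (hsy _ hf2).coeFn_toLp.symm
    filter_upwards [Lp.coeFn_add (f' : Lp ℝ 2 P) (ε • (ContinuousLinearMap.mul ℝ ℝ).holderL P ⊤ 2 2
        (hs.toLp s) (f' : Lp ℝ 2 P)), Lp.coeFn_smul ε ((ContinuousLinearMap.mul ℝ ℝ).holderL P ⊤ 2 2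
        (hs.toLp s) (f' : Lp ℝ 2 P)), (ContinuousLinearMap.mul ℝ ℝ).coeFn_holder (r := 2)
        (hs.toLp s) (f' : Lp ℝ 2 P), hs.coeFn_toLp] with o h1 h2 h3 h4
    rw [h1, Pi.add_apply, h2, Pi.smul_apply]
    change _ + ε • ((ContinuousLinearMap.mul ℝ ℝ).holder 2 (hs.toLp s) (f' : Lp ℝ 2 P)) o = _
    rw [h3, h4]
    simp only [ContinuousLinearMap.mul_apply', smul_eq_mul]
    ring
  have e1 := (hsy y hy).condExpL2_ae_eq_condExp (𝕜 := ℝ) hX'.comap_le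
  have e2 := (hsy _ hf2).condExpL2_ae_eq_condExp (𝕜 := ℝ) hX'.comap_le
  rw [← key] at e1
  rw [← key2] at e2
  have hsub := condExp_sub ((hsy y hy).integrable one_le_two) ((hsy _ hf2).integrable one_le_two)
    (mF.comap X')
  have hfun : (fun o => (1 + ε * s o) * (y o - (f' : Lp ℝ 2 P) o)) =
      (fun o => (1 + ε * s o) * y o) - fun o => (1 + ε * s o) * (f' : Lp ℝ 2 P) o := by
    ext o
    simp only [Pi.sub_apply]
    ring
  rw [hfun]
  filter_upwards [hsub, e1, e2] with o h1 h2 h3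
  rw [h1, Pi.sub_apply, ← h2, ← h3, sub_self, Pi.zero_apply]

end CondExpOperator

/-! ### Laws with density close to one -/

section Tilt

variable {O : Type*} {m : MeasurableSpace O} [mO : MeasurableSpace O] {P : Measure O} {g : O → ℝ}

/-- The density lies between `1/2` and `3/2`, so the factor `2` serves for domination in both
directions. The tilted law and `P` therefore have the same null sets and the same `L^p` functions.
-/
theorem withDensity_le_two_smul (hg : ∀ᵐ o ∂P, |g o - 1| ≤ 1 / 2) :
    P.withDensity (fun o => ENNReal.ofReal (g o)) ≤ (2 : ENNReal) • P := by
  rw [← withDensity_const]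
  refine withDensity_mono ?_
  filter_upwards [hg] with o ho
  have := (abs_le.1 ho).2
  refine (ENNReal.ofReal_le_ofReal (by linarith : g o ≤ 2)).trans (by simp)

theorem le_two_smul_withDensity (hgm : Measurable g) (hg : ∀ᵐ o ∂P, |g o - 1| ≤ 1 / 2) :
    P ≤ (2 : ENNReal) • P.withDensity (fun o => ENNReal.ofReal (g o)) := by
  rw [← withDensity_smul _ hgm.ennreal_ofReal]
  conv_lhs => rw [← withDensity_one (μ := P)]
  refine withDensity_mono ?_
  filter_upwards [hg] with o ho
  have h1 := (abs_le.1 ho).1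
  have h2 : (2 : ENNReal) * ENNReal.ofReal (g o) = ENNReal.ofReal (2 * g o) := by
    rw [ENNReal.ofReal_mul zero_le_two]
    simp
  simp only [Pi.one_apply, Pi.smul_apply, smul_eq_mul, h2]
  rw [← ENNReal.ofReal_one]
  exact ENNReal.ofReal_le_ofReal (by linarith)

theorem memLp_map_withDensity_iff {E : Type*} [MeasurableSpace E] {X : O → E} (hX : Measurable X)
    (hgm : Measurable g)
    (hg : ∀ᵐ o ∂P, |g o - 1| ≤ 1 / 2) {f : E → ℝ} {p : ENNReal} :
    MemLp f p ((P.withDensity (fun o => ENNReal.ofReal (g o))).map X) ↔ MemLp f p (P.map X) := by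
  constructor <;> intro hf
  · refine hf.of_measure_le_smul (c := 2) (by simp) ?_
    rw [← Measure.map_smul]
    exact Measure.map_mono (le_two_smul_withDensity hgm hg) hX
  · refine hf.of_measure_le_smul (c := 2) (by simp) ?_
    rw [← Measure.map_smul]
    exact Measure.map_mono (withDensity_le_two_smul hg) hX

theorem memLp_withDensity_iff (hgm : Measurable g) (hg : ∀ᵐ o ∂P, |g o - 1| ≤ 1 / 2)
    {f : O → ℝ} {p : ENNReal} :
    MemLp f p (P.withDensity (fun o => ENNReal.ofReal (g o))) ↔ MemLp f p P :=
  ⟨fun hf => hf.of_measure_le_smul (c := 2) (by simp) (le_two_smul_withDensity hgm hg),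
    fun hf => hf.of_measure_le_smul (c := 2) (by simp) (withDensity_le_two_smul hg)⟩

theorem ae_withDensity_iff_of_abs_sub_one_le (hgm : Measurable g)
    (hg : ∀ᵐ o ∂P, |g o - 1| ≤ 1 / 2) {p : O → Prop} :
    (∀ᵐ o ∂P.withDensity (fun o => ENNReal.ofReal (g o)), p o) ↔ ∀ᵐ o ∂P, p o :=
  ⟨fun h => Measure.absolutelyContinuous_of_le_smul (le_two_smul_withDensity hgm hg) |>.ae_le h,
    fun h => Measure.absolutelyContinuous_of_le_smul (withDensity_le_two_smul hg) |>.ae_le h⟩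

theorem integral_withDensity_ofReal (hgm : Measurable g) (hg : ∀ᵐ o ∂P, |g o - 1| ≤ 1 / 2)
    (f : O → ℝ) :
    ∫ o, f o ∂P.withDensity (fun o => ENNReal.ofReal (g o)) = ∫ o, g o * f o ∂P := by
  rw [integral_withDensity_eq_integral_toReal_smul hgm.ennreal_ofReal
    (ae_of_all _ fun _ => ENNReal.ofReal_lt_top)]
  refine integral_congr_ae ?_
  filter_upwards [hg] with o ho
  rw [ENNReal.toReal_ofReal (by linarith [(abs_le.1 ho).1]), smul_eq_mul]

theorem integrable_mul_of_abs_sub_one_le (hgm : Measurable g) {δ : ℝ}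
    (hg : ∀ᵐ o ∂P, |g o - 1| ≤ δ) {f : O → ℝ} (hf : Integrable f P) :
    Integrable (fun o => g o * f o) P := by
  refine hf.bdd_mul (c := δ + 1) hgm.aestronglyMeasurable ?_
  filter_upwards [hg] with o ho
  rw [Real.norm_eq_abs]
  have := abs_add_le (g o - 1) 1
  simp only [sub_add_cancel, abs_one] at this
  linarith

/-- Bayes' rule without its normalising denominator, which is irrelevant to vanishing. -/
theorem condExp_withDensity_ae_eq_zero_iff [IsFiniteMeasure P] (hm : m ≤ mO)
    (hgm : Measurable g) (hg : ∀ᵐ o ∂P, |g o - 1| ≤ 1 / 2)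
    [IsFiniteMeasure (P.withDensity (fun o => ENNReal.ofReal (g o)))] {f : O → ℝ}
    (hf : Integrable f P) :
    (P.withDensity (fun o => ENNReal.ofReal (g o)))[f | m]
        =ᵐ[P.withDensity (fun o => ENNReal.ofReal (g o))] 0 ↔
      P[fun o => g o * f o | m] =ᵐ[P] 0 := by
  have hfQ : Integrable f (P.withDensity (fun o => ENNReal.ofReal (g o))) :=
    memLp_one_iff_integrable.1 ((memLp_withDensity_iff hgm hg).2 (memLp_one_iff_integrable.2 hf))
  rw [condExp_ae_eq_zero_iff hm hfQ,
    condExp_ae_eq_zero_iff hm (integrable_mul_of_abs_sub_one_le hgm hg hf)]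
  refine forall₂_congr fun s hs => ?_
  rw [← integral_indicator (hm s hs), integral_withDensity_ofReal hgm hg,
    ← integral_indicator (hm s hs)]
  have : (fun o => g o * s.indicator f o) = s.indicator fun o => g o * f o := by
    ext o
    by_cases ho : o ∈ s <;> simp [ho]
  rw [this]

theorem lpNorm_le_mul_lpNorm_of_ae_le {f z : O → ℝ} (hf : AEStronglyMeasurable f P)
    (hz : MemLp z 2 P) {δ : ℝ} (hδ : 0 ≤ δ) (h : ∀ᵐ o ∂P, |f o| ≤ δ * |z o|) :
    lpNorm f 2 P ≤ δ * lpNorm z 2 P := by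
  rw [← toReal_eLpNorm hf, ← toReal_eLpNorm hz.1]
  have := eLpNorm_le_mul_eLpNorm_of_ae_le_mul (p := 2) (f := f) (g := z) h
  refine (ENNReal.toReal_mono (ENNReal.mul_ne_top ENNReal.ofReal_ne_top hz.2.ne) this).trans ?_
  rw [ENNReal.toReal_mul, ENNReal.toReal_ofReal hδ]

theorem lpNorm_condExp_le [IsFiniteMeasure P] {f : O → ℝ} (hf : MemLp f 2 P) :
    lpNorm (P[f | m]) 2 P ≤ lpNorm f 2 P := by
  rw [← toReal_eLpNorm (hf.condExp one_le_two).1, ← toReal_eLpNorm hf.1]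
  exact ENNReal.toReal_mono hf.2.ne (eLpNorm_condExp_le_eLpNorm f one_le_two)

/-- Stability of the conditional moment equation: if `E[y | m] = 0` and `E[g (y + k) | m] = 0` with
`g` uniformly close to `1`, then `k` is small. -/
theorem lpNorm_le_of_condExp_mul_eq_zero [IsFiniteMeasure P] {k y : O → ℝ} {C δ : ℝ}
    (hC : 0 ≤ C) (hδ : 0 ≤ δ) (hCδ : C * δ ≤ 1 / 2) (hk : MemLp k 2 P) (hy : MemLp y 2 P)
    (hbd : lpNorm k 2 P ≤ C * lpNorm (P[k | m]) 2 P) (hgm : Measurable g)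
    (hg : ∀ᵐ o ∂P, |g o - 1| ≤ δ) (hy0 : P[y | m] =ᵐ[P] 0)
    (hgk : P[fun o => g o * (y o + k o) | m] =ᵐ[P] 0) :
    lpNorm k 2 P ≤ 2 * C * δ * lpNorm y 2 P := by
  have hyk : MemLp (y + k) 2 P := hy.add hk
  have hyki : Integrable (y + k) P := hyk.integrable one_le_two
  have hgi : Integrable (fun o => g o * (y o + k o)) P :=
    integrable_mul_of_abs_sub_one_le hgm hg hyki
  set v : O → ℝ := fun o => (1 - g o) * (y o + k o) with hv
  have hva : ∀ᵐ o ∂P, |v o| ≤ δ * |(y + k) o| := by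
    filter_upwards [hg] with o ho
    rw [hv, abs_mul, abs_sub_comm]
    exact mul_le_mul_of_nonneg_right ho (abs_nonneg _)
  have hvm : AEStronglyMeasurable v P :=
    (measurable_const.sub hgm).aestronglyMeasurable.mul hyk.1
  have hv2 : MemLp v 2 P := hyk.of_le_mul hvm hva
  -- Both moment equations enter here: `E[k | m] = E[y + k | m]` by the first, and the second allows
  -- subtracting `g (y + k)`. What remains, `v = (1 - g)(y + k)`, is of size `δ`.
  have hkv : P[k | m] =ᵐ[P] P[v | m] := by
    have h1 := condExp_sub (hyki.sub hgi) (hy.integrable one_le_two) m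
    have h2 := condExp_sub hyki hgi m
    have h3 := condExp_add (hy.integrable one_le_two) (hk.integrable one_le_two) m
    have h4 : v = (y + k) - fun o => g o * (y o + k o) := by
      ext o
      simp only [hv, Pi.sub_apply, Pi.add_apply]
      ring
    rw [h4]
    filter_upwards [h2, h3, hy0, hgk] with o e2 e3 e4 e5
    rw [e2, Pi.sub_apply, e3, Pi.add_apply, e4, e5]
    simp
  have e1 : lpNorm (P[k | m]) 2 P ≤ δ * (lpNorm y 2 P + lpNorm k 2 P) := by
    have : lpNorm (P[k | m]) 2 P = lpNorm (P[v | m]) 2 P := by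
      rw [← toReal_eLpNorm (hk.condExp one_le_two).1, ← toReal_eLpNorm (hv2.condExp one_le_two).1,
        eLpNorm_congr_ae hkv]
    rw [this]
    calc lpNorm (P[v | m]) 2 P ≤ lpNorm v 2 P := lpNorm_condExp_le hv2
      _ ≤ δ * lpNorm (y + k) 2 P := lpNorm_le_mul_lpNorm_of_ae_le hvm hyk hδ hva
      _ ≤ _ := mul_le_mul_of_nonneg_left (lpNorm_add_le hy one_le_two) hδ
  have hk0 : 0 ≤ lpNorm k 2 P := lpNorm_nonneg
  have e2 : lpNorm k 2 P ≤ C * δ * lpNorm y 2 P + C * δ * lpNorm k 2 P := by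
    calc _ ≤ C * (δ * (lpNorm y 2 P + lpNorm k 2 P)) :=
          hbd.trans (mul_le_mul_of_nonneg_left e1 hC)
      _ = _ := by ring
  -- The term in `k` on the right is absorbed on the left, which costs the factor `2`.
  have e3 : C * δ * lpNorm k 2 P ≤ 1 / 2 * lpNorm k 2 P := mul_le_mul_of_nonneg_right hCδ hk0
  linarith

end Tilt

/-! ### The bridge equation as a conditional moment equation -/

section Bridge

variable {d : ℕ} {𝒲 𝒵 : Type*} [MeasurableSpace 𝒲] [MeasurableSpace 𝒵]
  {P : Measure (Obs d 𝒲 𝒵)}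

theorem isOutcomeBridge_iff [IsFiniteMeasure P] (hY : MemLp obsY 2 P)
    {h : 𝒲 → Fin (d + 1) → ℝ} :
    IsOutcomeBridge P h ↔ MemLp (fun x : 𝒲 × Fin (d + 1) => h x.1 x.2) 2 (P.map obsWA) ∧
      P[fun o => obsY o - h (obsW o) (obsA o) |
        MeasurableSpace.comap obsZA inferInstance] =ᵐ[P] 0 := by
  have key : ∀ hh : MemLp (fun x : 𝒲 × Fin (d + 1) => h x.1 x.2) 2 (P.map obsWA),
      P[fun o => obsY o - h (obsW o) (obsA o) | MeasurableSpace.comap obsZA inferInstance]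
        =ᵐ[P] P[obsY | MeasurableSpace.comap obsZA inferInstance] -
        P[fun o => h (obsW o) (obsA o) | MeasurableSpace.comap obsZA inferInstance] := fun hh =>
    condExp_sub (hY.integrable one_le_two) ((memLp_obsWA hh).integrable one_le_two) _
  constructor
  · intro hb
    refine ⟨hb.memLp, (key hb.memLp).trans ?_⟩
    filter_upwards [hb.bridge] with o ho
    rw [Pi.sub_apply, ho, sub_self, Pi.zero_apply]
  · rintro ⟨h1, h2⟩
    refine ⟨h1, ?_⟩
    filter_upwards [(key h1).symm.trans h2] with o ho
    exact sub_eq_zero.1 ho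

theorem isOutcomeBridge_withDensity_iff [IsFiniteMeasure P] (hY : MemLp obsY 2 P)
    {g : Obs d 𝒲 𝒵 → ℝ} (hgm : Measurable g) (hg : ∀ᵐ o ∂P, |g o - 1| ≤ 1 / 2)
    [IsFiniteMeasure (P.withDensity (fun o => ENNReal.ofReal (g o)))]
    {h : 𝒲 → Fin (d + 1) → ℝ} :
    IsOutcomeBridge (P.withDensity (fun o => ENNReal.ofReal (g o))) h ↔
      MemLp (fun x : 𝒲 × Fin (d + 1) => h x.1 x.2) 2 (P.map obsWA) ∧
      P[fun o => g o * (obsY o - h (obsW o) (obsA o)) |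
        MeasurableSpace.comap obsZA inferInstance] =ᵐ[P] 0 := by
  rw [isOutcomeBridge_iff ((memLp_withDensity_iff hgm hg).2 hY),
    memLp_map_withDensity_iff measurable_obsWA hgm hg]
  refine and_congr_right fun hh => ?_
  exact condExp_withDensity_ae_eq_zero_iff measurable_obsZA.comap_le hgm hg
    ((hY.sub (memLp_obsWA hh)).integrable one_le_two)

end Bridge

/-! ### Uniform bounds and limits -/

section Bounds

variable {O : Type*} [MeasurableSpace O] {P : Measure O}

theorem MemLp.exists_ae_abs_le {s : O → ℝ} (hs : MemLp s ⊤ P) :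
    ∃ M : ℝ, 0 ≤ M ∧ ∀ᵐ o ∂P, |s o| ≤ M := by
  refine ⟨(eLpNorm s ⊤ P).toReal, ENNReal.toReal_nonneg, ?_⟩
  filter_upwards [ae_le_eLpNormEssSup (f := s) (μ := P)] with o ho
  rw [← eLpNorm_exponent_top] at ho
  have := ENNReal.toReal_mono hs.2.ne ho
  rwa [toReal_enorm, Real.norm_eq_abs] at this

theorem eventually_ae_abs_le_of_tendsto_eLpNorm_top {l : Filter ℝ} {f : ℝ → O → ℝ}
    (h : Tendsto (fun ε => eLpNorm (f ε) ⊤ P) l (𝓝 0)) {η : ℝ} (hη : 0 < η) :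
    ∀ᶠ ε in l, ∀ᵐ o ∂P, |f ε o| ≤ η := by
  filter_upwards [h.eventually_le_const (ENNReal.ofReal_pos.2 hη)] with ε hε
  filter_upwards [ae_le_eLpNormEssSup (f := f ε) (μ := P)] with o ho
  rw [← eLpNorm_exponent_top] at ho
  have := ENNReal.toReal_mono ENNReal.ofReal_ne_top (ho.trans hε)
  rwa [toReal_enorm, Real.norm_eq_abs, ENNReal.toReal_ofReal hη.le] at this

theorem tendsto_of_forall_eventually_abs_sub_le {ι : Type*} {l : Filter ι} {f : ι → ℝ} {D K : ℝ}
    (hK : 0 ≤ K) (h : ∀ η : ℝ, 0 < η → η ≤ 1 → ∀ᶠ x in l, |f x - D| ≤ η * K) :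
    Tendsto f l (𝓝 D) := by
  rw [Metric.tendsto_nhds]
  intro e he
  have hK1 : 0 < K + 1 := by linarith
  filter_upwards [h (min 1 (e / (K + 1))) (lt_min one_pos (div_pos he hK1)) (min_le_left _ _)]
    with x hx
  rw [Real.dist_eq]
  calc |f x - D| ≤ min 1 (e / (K + 1)) * K := hx
    _ ≤ e / (K + 1) * K := mul_le_mul_of_nonneg_right (min_le_right _ _) hK
    _ < e / (K + 1) * (K + 1) := mul_lt_mul_of_pos_left (by linarith) (div_pos he hK1)
    _ = e := div_mul_cancel₀ _ hK1.ne'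

end Bounds

/-! ### Tilted submodels and the exact expansion -/

section Submodels

variable {d : ℕ} {𝒲 𝒵 : Type*} [MeasurableSpace 𝒲] [MeasurableSpace 𝒵]
  {P : Measure (Obs d 𝒲 𝒵)}

theorem aestronglyMeasurable_obsWA {k : 𝒲 → Fin (d + 1) → ℝ}
    (hk : AEStronglyMeasurable (fun x : 𝒲 × Fin (d + 1) => k x.1 x.2) (P.map obsWA)) :
    AEStronglyMeasurable[MeasurableSpace.comap obsWA inferInstance]
      (fun o => k (obsW o) (obsA o)) P :=
  hk.comp_ae_measurable' measurable_obsWA.aemeasurable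

variable [IsProbabilityMeasure P]

/-- Near `P`, a law with an outcome bridge function has a well-defined bridge value. -/
theorem isBridgeValue_withDensity (hY : MemLp obsY 2 P) {C δ : ℝ} (hC : 0 ≤ C)
    (hbd : ∀ f : Obs d 𝒲 𝒵 → ℝ, MemLp f 2 P →
      AEStronglyMeasurable[MeasurableSpace.comap obsWA inferInstance] f P →
      lpNorm f 2 P ≤ C * lpNorm (P[f | MeasurableSpace.comap obsZA inferInstance]) 2 P)
    {φ : 𝒵 → Fin (d + 1) → ℝ} (hφ : IsTreatmentBridge P φ) {g : Obs d 𝒲 𝒵 → ℝ}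
    (hgm : Measurable g) (hδ : 0 ≤ δ) (hδ' : δ ≤ 1 / 2) (hCδ : C * δ ≤ 1 / 2)
    (hg : ∀ᵐ o ∂P, |g o - 1| ≤ δ)
    [IsFiniteMeasure (P.withDensity (fun o => ENNReal.ofReal (g o)))]
    {h : 𝒲 → Fin (d + 1) → ℝ}
    (hh : IsOutcomeBridge (P.withDensity (fun o => ENNReal.ofReal (g o))) h) (a : Fin (d + 1)) :
    IsBridgeValue a (P.withDensity (fun o => ENNReal.ofReal (g o)))
      (∫ o, h (obsW o) a ∂P.withDensity (fun o => ENNReal.ofReal (g o))) := by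
  have hg2 : ∀ᵐ o ∂P, |g o - 1| ≤ 1 / 2 := hg.mono fun o ho => ho.trans hδ'
  refine ⟨⟨h, hh⟩, fun h' hh' => ?_⟩
  rw [isOutcomeBridge_withDensity_iff hY hgm hg2] at hh hh'
  have hkm : MemLp (fun x : 𝒲 × Fin (d + 1) => (fun w a => h w a - h' w a) x.1 x.2) 2
    (P.map obsWA) := hh.1.sub hh'.1
  have hk2 := memLp_obsWA (k := fun w a => h w a - h' w a) hkm
  have hi : ∀ {h : 𝒲 → Fin (d + 1) → ℝ},
      MemLp (fun x : 𝒲 × Fin (d + 1) => h x.1 x.2) 2 (P.map obsWA) →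
      Integrable (fun o => g o * (obsY o - h (obsW o) (obsA o))) P := fun hh =>
    integrable_mul_of_abs_sub_one_le hgm hg ((hY.sub (memLp_obsWA hh)).integrable one_le_two)
  have hk0 : lpNorm (fun o => h (obsW o) (obsA o) - h' (obsW o) (obsA o)) 2 P = 0 := by
    refine le_antisymm ?_ lpNorm_nonneg
    -- Stability with `y = 0`: the difference of two bridge functions for the tilted law solves the
    -- homogeneous equation and so vanishes.
    have := lpNorm_le_of_condExp_mul_eq_zero (m := MeasurableSpace.comap obsZA inferInstance)
      (y := 0) hC hδ hCδ hk2 MemLp.zero 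
      (hbd _ hk2 (aestronglyMeasurable_obsWA (k := fun w a => h w a - h' w a) hkm.1)) hgm hg
      (by rw [condExp_zero]) ?_
    · simpa using this
    · have hs := condExp_sub (hi hh'.1) (hi hh.1) (MeasurableSpace.comap obsZA inferInstance)
      refine EventuallyEq.trans (EventuallyEq.of_eq ?_) (hs.trans ?_)
      · congr 1
        ext o
        simp only [Pi.zero_apply, Pi.sub_apply]
        ring
      · filter_upwards [hh.2, hh'.2] with o h1 h2
        rw [Pi.sub_apply, h1, h2, Pi.zero_apply, sub_zero]
  have hka := hφ.integrable_and_integral_eq (k := fun w a => h w a - h' w a) hkm a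
  have hab := hφ.integral_abs_le (k := fun w a => h w a - h' w a) hkm a
  rw [hk0, mul_zero] at hab
  have hae : ∀ᵐ o ∂P, |h (obsW o) a - h' (obsW o) a| = 0 :=
    (integral_eq_zero_iff_of_nonneg (fun _ => abs_nonneg _) hka.1.abs).1
      (le_antisymm hab (integral_nonneg fun _ => abs_nonneg _))
  constructor
  · exact memLp_one_iff_integrable.1 ((memLp_withDensity_iff hgm hg2).2
      (memLp_one_iff_integrable.2 (hφ.integrable_and_integral_eq hh'.1 a).1))
  · refine integral_congr_ae ((ae_withDensity_iff_of_abs_sub_one_le hgm hg2).2 ?_)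
    filter_upwards [hae] with o ho
    exact (sub_eq_zero.1 (abs_eq_zero.1 ho)).symm

/-- Tilts `1 + ε s` of `P` by bounded functions `s` of mean zero stay in the model. -/
theorem eventually_tilt_mem_bridgeModel (hY : MemLp obsY 2 P)
    (hT : CondExpSurjective P obsWA obsZA) (hTstar : CondExpSurjective P obsZA obsWA)
    {φ : 𝒵 → Fin (d + 1) → ℝ} (hφ : IsTreatmentBridge P φ) {s : Obs d 𝒲 𝒵 → ℝ}
    (hsm : Measurable s) (hs : MemLp s ⊤ P) (hs0 : ∫ o, s o ∂P = 0) (a : Fin (d + 1)) :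
    ∀ᶠ ε in 𝓝 (0 : ℝ), P.withDensity (fun o => ENNReal.ofReal (1 + ε * s o)) ∈
      bridgeModel d 𝒲 𝒵 a := by
  obtain ⟨C, hC, hbd⟩ := hT.exists_lpNorm_le measurable_obsWA measurable_obsZA hTstar
  obtain ⟨M, hM, hsM⟩ := MemLp.exists_ae_abs_le hs
  have hsmall : ∀ c : ℝ, ∀ᶠ ε in 𝓝 (0 : ℝ), c * (|ε| * M) < 1 / 2 := by
    intro c
    have : Tendsto (fun ε : ℝ => c * (|ε| * M)) (𝓝 0) (𝓝 (c * (|0| * M))) :=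
      Continuous.tendsto (by fun_prop) 0
    refine this.eventually_lt_const ?_
    simp
  filter_upwards [hsmall 1, hsmall C, hT.eventually_exists_condExp_eq_zero measurable_obsWA
    measurable_obsZA hTstar hs] with ε h1 h2 h3
  rw [one_mul] at h1
  have hgm : Measurable fun o => 1 + ε * s o := (hsm.const_mul ε).const_add 1
  have hg : ∀ᵐ o ∂P, |(1 + ε * s o) - 1| ≤ |ε| * M := by
    filter_upwards [hsM] with o ho
    rw [add_sub_cancel_left, abs_mul]
    exact mul_le_mul_of_nonneg_left ho (abs_nonneg _)
  have hg2 : ∀ᵐ o ∂P, |(1 + ε * s o) - 1| ≤ 1 / 2 := hg.mono fun o ho => ho.trans h1.le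
  have hprob : IsProbabilityMeasure (P.withDensity (fun o => ENNReal.ofReal (1 + ε * s o))) := by
    refine ⟨?_⟩
    have hsi : Integrable s P := hs.integrable le_top
    have hgi : Integrable (fun o => 1 + ε * s o) P := (integrable_const 1).add (hsi.const_mul ε)
    rw [withDensity_apply _ .univ, Measure.restrict_univ, ← ofReal_integral_eq_lintegral_ofReal hgi,
      integral_add (integrable_const 1) (hsi.const_mul ε), integral_const_mul, hs0]
    · simp
    -- Nonnegativity of the density: `ENNReal.ofReal` truncates nothing, and the total mass is `1 +
    -- ε E[s] = 1`.
    · filter_upwards [hg2] with o ho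
      have := (abs_le.1 ho).1
      simp only [Pi.zero_apply]
      linarith
  obtain ⟨f, hf2, hfm, hf0⟩ := h3 obsY hY
  obtain ⟨l, hl, hfl⟩ := exists_ae_eq_comp_of_aestronglyMeasurable_comap hfm
  have hbr : IsOutcomeBridge (P.withDensity (fun o => ENNReal.ofReal (1 + ε * s o)))
      (fun w a => l (w, a)) := by
    rw [isOutcomeBridge_withDensity_iff hY hgm hg2]
    constructor
    · exact (memLp_map_measure_iff hl.aestronglyMeasurable measurable_obsWA.aemeasurable).2
        ((memLp_congr_ae hfl).1 hf2)
    · refine EventuallyEq.trans (condExp_congr_ae ?_) hf0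
      filter_upwards [hfl] with o ho
      rw [ho]
      rfl
  exact ⟨hprob, (memLp_withDensity_iff hgm hg2).2 hY, _, isBridgeValue_withDensity hY hC hbd hφ hgm
    (mul_nonneg (abs_nonneg _) hM) h1.le h2.le hg hbr a⟩

theorem isSmoothSubmodel_tilt (hY : MemLp obsY 2 P)
    (hT : CondExpSurjective P obsWA obsZA) (hTstar : CondExpSurjective P obsZA obsWA)
    {φ : 𝒵 → Fin (d + 1) → ℝ} (hφ : IsTreatmentBridge P φ) {s : Obs d 𝒲 𝒵 → ℝ}
    (hsm : Measurable s) (hs : MemLp s ⊤ P) (hs0 : ∫ o, s o ∂P = 0) (a : Fin (d + 1)) :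
    IsSmoothSubmodel (bridgeModel d 𝒲 𝒵 a) P
      (fun ε => P.withDensity (fun o => ENNReal.ofReal (1 + ε * s o))) s where
  zero := by simp
  mem := eventually_tilt_mem_bridgeModel hY hT hTstar hφ hsm hs hs0 a
  score_bdd := hs
  density := by
    refine ⟨fun ε o => 1 + ε * s o, fun ε => (hsm.const_mul ε).const_add 1,
      Eventually.of_forall fun _ => rfl, ?_⟩
    refine tendsto_const_nhds.congr' ?_
    filter_upwards [self_mem_nhdsWithin] with ε hε
    have hε' : ε ≠ 0 := hε
    have : (fun o => (1 + ε * s o - 1) / ε - s o) = 0 := by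
      ext o
      simp only [Pi.zero_apply]
      field_simp
      ring
    rw [this, eLpNorm_zero]

/-- The weight is a function of `(Z, A)`, so only the conditional mean of `r` given `(Z, A)`
matters. -/
theorem IsTreatmentBridge.integral_bridgeWeight_mul_eq_zero {φ : 𝒵 → Fin (d + 1) → ℝ}
    (hφ : IsTreatmentBridge P φ) (a : Fin (d + 1)) {r : Obs d 𝒲 𝒵 → ℝ} (hr : Integrable r P)
    (hqr : Integrable (fun o => bridgeWeight P φ a o * r o) P)
    (h0 : P[r | MeasurableSpace.comap obsZA inferInstance] =ᵐ[P] 0) :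
    ∫ o, bridgeWeight P φ a o * r o ∂P = 0 := by
  rw [← integral_mul_condExp measurable_obsZA.comap_le (hφ.aestronglyMeasurable_bridgeWeight a) hr
    hqr, ← integral_zero (Obs d 𝒲 𝒵) ℝ (μ := P)]
  refine integral_congr_ae ?_
  filter_upwards [h0] with o ho
  rw [ho, Pi.zero_apply, mul_zero]

/-- The exact expansion of the bridge functional at a law with density `g` with respect to `P`. -/
theorem integral_bridge_sub_integral_bridge (hY : MemLp obsY 2 P)
    {h₀ h : 𝒲 → Fin (d + 1) → ℝ} (hh₀ : IsOutcomeBridge P h₀)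
    {φ : 𝒵 → Fin (d + 1) → ℝ} (hφ : IsTreatmentBridge P φ) {g : Obs d 𝒲 𝒵 → ℝ}
    (hgm : Measurable g) {δ : ℝ} (hg : ∀ᵐ o ∂P, |g o - 1| ≤ δ)
    (hh : MemLp (fun x : 𝒲 × Fin (d + 1) => h x.1 x.2) 2 (P.map obsWA))
    (hh' : P[fun o => g o * (obsY o - h (obsW o) (obsA o)) |
        MeasurableSpace.comap obsZA inferInstance] =ᵐ[P] 0) (a : Fin (d + 1)) :
    ∫ o, g o * h (obsW o) a ∂P - ∫ o, h₀ (obsW o) a ∂P =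
      ∫ o, (g o - 1) * (h (obsW o) a +
        bridgeWeight P φ a o * (obsY o - h (obsW o) (obsA o))) ∂P := by
  set q := bridgeWeight P φ a with hq
  have hq2 : MemLp q 2 P := hφ.memLp_bridgeWeight a
  have h01 := hh₀.memLp
  have h02 := ((isOutcomeBridge_iff hY).1 hh₀).2
  have hr : MemLp (fun o => obsY o - h (obsW o) (obsA o)) 2 P := hY.sub (memLp_obsWA hh)
  have hr₀ : MemLp (fun o => obsY o - h₀ (obsW o) (obsA o)) 2 P := hY.sub (memLp_obsWA h01)
  have iqr : Integrable (fun o => q o * (obsY o - h (obsW o) (obsA o))) P := hq2.integrable_mul hr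
  have iqr₀ : Integrable (fun o => q o * (obsY o - h₀ (obsW o) (obsA o))) P :=
    hq2.integrable_mul hr₀
  have igqr : Integrable (fun o => q o * (g o * (obsY o - h (obsW o) (obsA o)))) P :=
    (integrable_mul_of_abs_sub_one_le hgm hg iqr).congr (ae_of_all _ fun o => by ring)
  have ir : Integrable (fun o => g o * (obsY o - h (obsW o) (obsA o))) P :=
    integrable_mul_of_abs_sub_one_le hgm hg (hr.integrable one_le_two)
  have z1 : ∫ o, q o * (obsY o - h₀ (obsW o) (obsA o)) ∂P = 0 :=
    hφ.integral_bridgeWeight_mul_eq_zero a (hr₀.integrable one_le_two) iqr₀ h02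
  have z2 : ∫ o, q o * (g o * (obsY o - h (obsW o) (obsA o))) ∂P = 0 :=
    hφ.integral_bridgeWeight_mul_eq_zero a ir igqr hh'
  obtain ⟨i1, e1⟩ := hφ.integrable_and_integral_eq hh a
  obtain ⟨i0, e0⟩ := hφ.integrable_and_integral_eq h01 a
  have ig1 := integrable_mul_of_abs_sub_one_le hgm hg i1
  have iqh : Integrable (fun o => q o * h (obsW o) (obsA o)) P :=
    hq2.integrable_mul (memLp_obsWA hh)
  have iqh₀ : Integrable (fun o => q o * h₀ (obsW o) (obsA o)) P :=
    hq2.integrable_mul (memLp_obsWA h01)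
  have e2 : ∫ o, q o * (obsY o - h (obsW o) (obsA o)) ∂P
      = ∫ o, q o * (obsY o - h₀ (obsW o) (obsA o)) ∂P + ∫ o, q o * h₀ (obsW o) (obsA o) ∂P
        - ∫ o, q o * h (obsW o) (obsA o) ∂P := by
    have i2 : Integrable (fun o => q o * (obsY o - h₀ (obsW o) (obsA o)) +
        q o * h₀ (obsW o) (obsA o)) P := iqr₀.add iqh₀
    rw [← integral_add iqr₀ iqh₀, ← integral_sub i2 iqh]
    congr 1
    ext o
    ring
  have e3 : ∫ o, (g o - 1) * (h (obsW o) a + q o * (obsY o - h (obsW o) (obsA o))) ∂P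
      = ∫ o, g o * h (obsW o) a ∂P - ∫ o, h (obsW o) a ∂P
        + ∫ o, q o * (g o * (obsY o - h (obsW o) (obsA o))) ∂P
        - ∫ o, q o * (obsY o - h (obsW o) (obsA o)) ∂P := by
    have i2 : Integrable (fun o => g o * h (obsW o) a - h (obsW o) a) P := ig1.sub i1
    have i3 : Integrable (fun o => g o * h (obsW o) a - h (obsW o) a +
        q o * (g o * (obsY o - h (obsW o) (obsA o)))) P := i2.add igqr
    rw [← integral_sub ig1 i1, ← integral_add i2 igqr, ← integral_sub i3 iqr]
    congr 1
    ext o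
    ring
  -- After both residual terms vanish, the representer turns `E[q h]` and `E[q h₀]` into `E[h(W,
  -- a)]` and `E[h₀(W, a)]`; the former cancels.
  rw [e3, z2, e2, z1, e1, e0]
  ring

end Submodels

/-! ### Pathwise derivative of the bridge functional -/

section Pathwise

theorem abs_integral_mul_sub_integral_mul_le {O : Type*} [MeasurableSpace O] {P : Measure O}
    {r s F F₀ : O → ℝ} {η B : ℝ} (hr : AEStronglyMeasurable r P) (hs : AEStronglyMeasurable s P)
    (hF : Integrable F P) (hF₀ : Integrable F₀ P) (hrs : ∀ᵐ o ∂P, |r o - s o| ≤ η)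
    (hrB : ∀ᵐ o ∂P, |r o| ≤ B) :
    |∫ o, r o * F o ∂P - ∫ o, s o * F₀ o ∂P| ≤
      η * ∫ o, |F₀ o| ∂P + B * ∫ o, |F o - F₀ o| ∂P := by
  have i1 : Integrable (fun o => r o * F o) P := hF.bdd_mul hr hrB
  have i2 : Integrable (fun o => (r o - s o) * F₀ o) P := hF₀.bdd_mul (hr.sub hs) hrs
  have i2' : Integrable (fun o => r o * F₀ o) P := hF₀.bdd_mul hr hrB
  have i3 : Integrable (fun o => s o * F₀ o) P :=
    (i2'.sub i2).congr (ae_of_all _ fun o => by simp only [Pi.sub_apply]; ring)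
  have i4 : Integrable (fun o => B * |F o - F₀ o|) P := (hF.sub hF₀).abs.const_mul B
  rw [← integral_sub i1 i3, ← integral_const_mul, ← integral_const_mul, ← integral_add
    (hF₀.abs.const_mul η) i4]
  refine (abs_integral_le_integral_abs).trans (integral_mono_ae (i1.sub i3).abs
    ((hF₀.abs.const_mul η).add i4) ?_)
  filter_upwards [hrs, hrB] with o h1 h2
  have : r o * F o - s o * F₀ o = (r o - s o) * F₀ o + r o * (F o - F₀ o) := by ring
  simp only [this]
  refine (abs_add_le _ _).trans ?_
  rw [abs_mul, abs_mul]
  exact add_le_add (mul_le_mul_of_nonneg_right h1 (abs_nonneg _))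
    (mul_le_mul_of_nonneg_right h2 (abs_nonneg _))

variable {d : ℕ} {𝒲 𝒵 : Type*} [MeasurableSpace 𝒲] [MeasurableSpace 𝒵]
  {P : Measure (Obs d 𝒲 𝒵)}

theorem IsSmoothSubmodel.eventually_density {a : Fin (d + 1)} {Q : ℝ → Measure (Obs d 𝒲 𝒵)}
    {s : Obs d 𝒲 𝒵 → ℝ} (hS : IsSmoothSubmodel (bridgeModel d 𝒲 𝒵 a) P Q s) :
    ∃ B : ℝ, 0 ≤ B ∧ ∃ g : ℝ → Obs d 𝒲 𝒵 → ℝ, (∀ ε, Measurable (g ε)) ∧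
      ∀ η : ℝ, 0 < η → ∀ᶠ ε in 𝓝[≠] (0 : ℝ), ε ≠ 0 ∧ |ε| ≤ η ∧
        Q ε = P.withDensity (fun o => ENNReal.ofReal (g ε o)) ∧ Q ε ∈ bridgeModel d 𝒲 𝒵 a ∧
        (∀ᵐ o ∂P, |(g ε o - 1) / ε - s o| ≤ η) ∧ (∀ᵐ o ∂P, |(g ε o - 1) / ε| ≤ B) ∧
        (∀ᵐ o ∂P, |g ε o - 1| ≤ |ε| * B) := by
  obtain ⟨M, hM, hsM⟩ := MemLp.exists_ae_abs_le hS.score_bdd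
  obtain ⟨g, hgm, hQ, hlim⟩ := hS.density
  -- `M` bounds the score, and the difference quotients are eventually within `1` of it.
  refine ⟨M + 1, by linarith, g, hgm, fun η hη => ?_⟩
  have habs : ∀ᶠ ε in 𝓝[≠] (0 : ℝ), |ε| ≤ η := by
    have : Tendsto (fun ε : ℝ => |ε|) (𝓝[≠] 0) (𝓝 |0|) :=
      (continuous_abs.tendsto 0).mono_left nhdsWithin_le_nhds
    exact this.eventually_le_const (by simpa using hη)
  filter_upwards [self_mem_nhdsWithin, habs, hQ.filter_mono nhdsWithin_le_nhds,
    hS.mem.filter_mono nhdsWithin_le_nhds, eventually_ae_abs_le_of_tendsto_eLpNorm_top hlim hη,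
    eventually_ae_abs_le_of_tendsto_eLpNorm_top hlim one_pos] with ε h1 h2 h3 h4 h5 h6
  have h1' : ε ≠ 0 := h1
  have h7 : ∀ᵐ o ∂P, |(g ε o - 1) / ε| ≤ M + 1 := by
    filter_upwards [h6, hsM] with o ho ho'
    have := abs_add_le ((g ε o - 1) / ε - s o) (s o)
    rw [sub_add_cancel] at this
    linarith
  refine ⟨h1', h2, h3, h4, h5, h7, ?_⟩
  filter_upwards [h7] with o ho
  rwa [abs_div, div_le_iff₀ (abs_pos.2 h1'), mul_comm] at ho

variable [IsProbabilityMeasure P]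

/-- Total mass is one along the submodel, so the difference quotients of the density integrate to
zero, and they converge uniformly to the score. -/
theorem IsSmoothSubmodel.integral_score_eq_zero {a : Fin (d + 1)}
    {Q : ℝ → Measure (Obs d 𝒲 𝒵)}
    {s : Obs d 𝒲 𝒵 → ℝ} (hS : IsSmoothSubmodel (bridgeModel d 𝒲 𝒵 a) P Q s) :
    ∫ o, s o ∂P = 0 := by
  obtain ⟨B, hB, g, hgm, hev⟩ := hS.eventually_density
  have hsi : Integrable s P := hS.score_bdd.integrable le_top
  refine abs_nonpos_iff.1 (le_of_forall_pos_le_add fun η hη => ?_)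
  have hη' : 0 < min η (1 / (2 * (B + 1))) := lt_min hη (by positivity)
  obtain ⟨ε, hε, hεη, hQ, hmem, hη1, hgB, hg⟩ := (hev _ hη').exists
  have hεB : |ε| * B ≤ 1 / 2 := by
    have h1 : |ε| ≤ 1 / (2 * (B + 1)) := hεη.trans (min_le_right _ _)
    rw [le_div_iff₀ (by positivity)] at h1
    nlinarith [abs_nonneg ε]
  have hg2 : ∀ᵐ o ∂P, |g ε o - 1| ≤ 1 / 2 := hg.mono fun o ho => ho.trans hεB
  have hprob : IsProbabilityMeasure (Q ε) := hmem.1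
  have h1 : ∫ o, g ε o ∂P = 1 := by
    have := integral_withDensity_ofReal (hgm ε) hg2 (fun _ => 1)
    rw [← hQ] at this
    simpa using this.symm
  have hgi : Integrable (g ε) P := by
    simpa using integrable_mul_of_abs_sub_one_le (hgm ε) hg2 (integrable_const (1 : ℝ))
  have hri : Integrable (fun o => (g ε o - 1) / ε) P := (hgi.sub (integrable_const 1)).div_const ε
  have h2 : ∫ o, (g ε o - 1) / ε ∂P = 0 := by
    rw [integral_div, integral_sub hgi (integrable_const 1), h1]
    simp
  have h3 : ∫ o, s o ∂P = - ∫ o, ((g ε o - 1) / ε - s o) ∂P := by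
    rw [integral_sub hri hsi, h2]
    ring
  rw [h3, abs_neg, zero_add]
  refine abs_integral_le_integral_abs.trans ?_
  calc ∫ o, |(g ε o - 1) / ε - s o| ∂P ≤ ∫ _, η ∂P :=
        integral_mono_ae (hri.sub hsi).abs (integrable_const η)
          (hη1.mono fun o ho => ho.trans (min_le_left _ _))
    _ = η := by simp

/-- The bridge function occurs twice in the integrand, in the section at `a` and multiplied by the
weight. Each occurrence costs the norm of the weight, hence the factor `2`. -/
theorem integral_abs_bridgeIntegrand_sub_le (hY : MemLp obsY 2 P)
    {φ : 𝒵 → Fin (d + 1) → ℝ} (hφ : IsTreatmentBridge P φ) {h₀ h : 𝒲 → Fin (d + 1) → ℝ}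
    (hh₀ : MemLp (fun x : 𝒲 × Fin (d + 1) => h₀ x.1 x.2) 2 (P.map obsWA))
    (hh : MemLp (fun x : 𝒲 × Fin (d + 1) => h x.1 x.2) 2 (P.map obsWA)) (a : Fin (d + 1)) :
    ∫ o, |(h (obsW o) a + bridgeWeight P φ a o * (obsY o - h (obsW o) (obsA o))) -
        (h₀ (obsW o) a + bridgeWeight P φ a o * (obsY o - h₀ (obsW o) (obsA o)))| ∂P ≤
      2 * lpNorm (bridgeWeight P φ a) 2 P *
        lpNorm (fun o => h₀ (obsW o) (obsA o) - h (obsW o) (obsA o)) 2 P := by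
  set q := bridgeWeight P φ a
  have hq2 : MemLp q 2 P := hφ.memLp_bridgeWeight a
  have hkm : MemLp (fun x : 𝒲 × Fin (d + 1) => (fun w a => h₀ w a - h w a) x.1 x.2) 2
    (P.map obsWA) := hh₀.sub hh
  have hk2 := memLp_obsWA (k := fun w a => h₀ w a - h w a) hkm
  have hi := (hφ.integrable_and_integral_eq (k := fun w a => h₀ w a - h w a) hkm a).1
  have hab := hφ.integral_abs_le (k := fun w a => h₀ w a - h w a) hkm a
  have hqk : Integrable (fun o => q o * (h₀ (obsW o) (obsA o) - h (obsW o) (obsA o))) P :=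
    hq2.integrable_mul hk2
  have hqk2 : ∫ o, |q o * (h₀ (obsW o) (obsA o) - h (obsW o) (obsA o))| ∂P ≤
      lpNorm q 2 P * lpNorm (fun o => h₀ (obsW o) (obsA o) - h (obsW o) (obsA o)) 2 P := by
    rw [← lpNorm_fun_abs hq2.1, ← lpNorm_fun_abs hk2.1]
    simp only [abs_mul]
    exact (le_abs_self _).trans (integral_mul_le_lpNorm_mul_lpNorm hq2.abs hk2.abs)
  have i1 : Integrable (fun o => h (obsW o) a + q o * (obsY o - h (obsW o) (obsA o))) P :=
    (hφ.integrable_and_integral_eq hh a).1.add (hq2.integrable_mul (hY.sub (memLp_obsWA hh)))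
  have i0 : Integrable (fun o => h₀ (obsW o) a + q o * (obsY o - h₀ (obsW o) (obsA o))) P :=
    (hφ.integrable_and_integral_eq hh₀ a).1.add (hq2.integrable_mul (hY.sub (memLp_obsWA hh₀)))
  calc _ ≤ ∫ o, (|h₀ (obsW o) a - h (obsW o) a| +
        |q o * (h₀ (obsW o) (obsA o) - h (obsW o) (obsA o))|) ∂P := by
        refine integral_mono (i1.sub i0).abs (hi.abs.add hqk.abs) fun o => ?_
        have e : (h (obsW o) a + q o * (obsY o - h (obsW o) (obsA o))) -
            (h₀ (obsW o) a + q o * (obsY o - h₀ (obsW o) (obsA o))) =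
            -(h₀ (obsW o) a - h (obsW o) a) +
              q o * (h₀ (obsW o) (obsA o) - h (obsW o) (obsA o)) := by ring
        simp only [e]
        refine (abs_add_le _ _).trans ?_
        rw [abs_neg]
    _ ≤ _ := by
        rw [integral_add hi.abs hqk.abs]
        linarith

/-- The derivative of the bridge functional along a smooth submodel. -/
theorem IsSmoothSubmodel.hasDerivAt_doseResponse (hY : MemLp obsY 2 P)
    (hT : CondExpSurjective P obsWA obsZA) (hTstar : CondExpSurjective P obsZA obsWA)
    {h₀ : 𝒲 → Fin (d + 1) → ℝ} (hh₀ : IsOutcomeBridge P h₀)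
    {φ : 𝒵 → Fin (d + 1) → ℝ} (hφ : IsTreatmentBridge P φ) {a : Fin (d + 1)}
    {Q : ℝ → Measure (Obs d 𝒲 𝒵)}
    {s : Obs d 𝒲 𝒵 → ℝ} (hS : IsSmoothSubmodel (bridgeModel d 𝒲 𝒵 a) P Q s) (θ : ℝ) :
    HasDerivAt (fun ε => doseResponseFunctional a (Q ε))
      (∫ o, psiATE P h₀ φ θ a o * s o ∂P) 0 := by
  obtain ⟨C, hC, hbd⟩ := hT.exists_lpNorm_le measurable_obsWA measurable_obsZA hTstar
  obtain ⟨B, hB, g, hgm, hev⟩ := hS.eventually_density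
  set q := bridgeWeight P φ a with hq
  have hq2 : MemLp q 2 P := hφ.memLp_bridgeWeight a
  have hsm : AEStronglyMeasurable s P := hS.score_bdd.1
  have h02 := ((isOutcomeBridge_iff hY).1 hh₀).2
  have hr₀ : MemLp (fun o => obsY o - h₀ (obsW o) (obsA o)) 2 P :=
    hY.sub (memLp_obsWA hh₀.memLp)
  set F₀ : Obs d 𝒲 𝒵 → ℝ := fun o => h₀ (obsW o) a + q o * (obsY o - h₀ (obsW o) (obsA o))
    with hF₀
  have iF₀ : Integrable F₀ P :=
    (hφ.integrable_and_integral_eq hh₀.memLp a).1.add (hq2.integrable_mul hr₀)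
  have hD : ∫ o, psiATE P h₀ φ θ a o * s o ∂P = ∫ o, s o * F₀ o ∂P := by
    obtain ⟨M, -, hsM⟩ := MemLp.exists_ae_abs_le hS.score_bdd
    have isF : Integrable (fun o => s o * F₀ o) P := iF₀.bdd_mul hsm hsM
    have iss : Integrable (fun o => θ * s o) P := (hS.score_bdd.integrable le_top).const_mul θ
    have : ∫ o, θ * s o ∂P = 0 := by rw [integral_const_mul, hS.integral_score_eq_zero, mul_zero]
    rw [← sub_zero (∫ o, s o * F₀ o ∂P), ← this, ← integral_sub isF iss]
    congr 1
    ext o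
    simp only [psiATE, hF₀, hq, bridgeWeight]
    ring
  have hP0 : P ∈ bridgeModel d 𝒲 𝒵 a := hS.zero ▸ hS.mem.self_of_nhds
  have hθ0 : doseResponseFunctional a P = ∫ o, h₀ (obsW o) a ∂P := by
    obtain ⟨-, -, t, ht⟩ := hP0
    rw [doseResponseFunctional_eq ht, (ht.2 h₀ hh₀).2]
  rw [hD, hasDerivAt_iff_tendsto_slope_zero]
  have hK1 : 0 ≤ ∫ o, |F₀ o| ∂P := integral_nonneg fun _ => abs_nonneg _
  -- `B` bounds the difference quotient, `2 ‖q‖` is the dependence of the integrand on the bridge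
  -- function, and the inner factor is the stability constant per unit of `|ε|`.
  set K2 : ℝ := B * (2 * lpNorm q 2 P *
    (2 * C * B * lpNorm (fun o => obsY o - h₀ (obsW o) (obsA o)) 2 P)) with hK2def
  have hK2 : 0 ≤ K2 := by
    have h1 : 0 ≤ lpNorm q 2 P := lpNorm_nonneg
    have h2 : 0 ≤ lpNorm (fun o => obsY o - h₀ (obsW o) (obsA o)) 2 P := lpNorm_nonneg
    positivity
  refine tendsto_of_forall_eventually_abs_sub_le (K := ∫ o, |F₀ o| ∂P + K2) (by linarith)
    fun η hη _ => ?_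
  -- Chosen so that both `|ε| B` and `C |ε| B` are at most `1/2`, as the tilting and stability
  -- lemmas require; adding `1` avoids a zero denominator.
  have hpos : 0 < min η (1 / (2 * ((C + 1) * (B + 1)))) := lt_min hη (by positivity)
  filter_upwards [hev _ hpos] with ε hε'
  obtain ⟨hε, hεη, hQ, hmem, hη1, hgB, hg⟩ := hε'
  have hεη' : |ε| ≤ η := hεη.trans (min_le_left _ _)
  have hη1' : ∀ᵐ o ∂P, |(g ε o - 1) / ε - s o| ≤ η :=
    hη1.mono fun o ho => ho.trans (min_le_left _ _)
  have hε0 : 0 ≤ |ε| := abs_nonneg ε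
  have hεCB : |ε| * (2 * ((C + 1) * (B + 1))) ≤ 1 := by
    have h1 : |ε| ≤ 1 / (2 * ((C + 1) * (B + 1))) := hεη.trans (min_le_right _ _)
    rwa [le_div_iff₀ (by positivity)] at h1
  have hexp : |ε| * (2 * ((C + 1) * (B + 1))) =
    2 * (C * (|ε| * B)) + 2 * (|ε| * B) + 2 * (|ε| * C) + 2 * |ε| := by ring
  have n1 : 0 ≤ |ε| * B := mul_nonneg hε0 hB
  have n2 : 0 ≤ |ε| * C := mul_nonneg hε0 hC
  have n3 : 0 ≤ C * (|ε| * B) := mul_nonneg hC n1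
  have hεB : |ε| * B ≤ 1 / 2 := by linarith
  have hεC : C * (|ε| * B) ≤ 1 / 2 := by linarith
  have hg2 : ∀ᵐ o ∂P, |g ε o - 1| ≤ 1 / 2 := hg.mono fun o ho => ho.trans hεB
  obtain ⟨hprob, -, t, ht⟩ := hmem
  obtain ⟨h, hh⟩ := ht.1
  have hθ : doseResponseFunctional a (Q ε) = ∫ o, g ε o * h (obsW o) a ∂P := by
    rw [doseResponseFunctional_eq ht, ← (ht.2 h hh).2, hQ, integral_withDensity_ofReal (hgm ε) hg2]
  rw [hQ] at hprob hh
  rw [isOutcomeBridge_withDensity_iff hY (hgm ε) hg2] at hh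
  have hexpand := integral_bridge_sub_integral_bridge hY hh₀ hφ (hgm ε) hg hh.1 hh.2 a
  have iF : Integrable (fun o => h (obsW o) a + q o * (obsY o - h (obsW o) (obsA o))) P :=
    (hφ.integrable_and_integral_eq hh.1 a).1.add (hq2.integrable_mul (hY.sub (memLp_obsWA hh.1)))
  have hslope : ε⁻¹ • (doseResponseFunctional a (Q (0 + ε)) - doseResponseFunctional a (Q 0)) =
      ∫ o, ((g ε o - 1) / ε) * (h (obsW o) a + q o * (obsY o - h (obsW o) (obsA o))) ∂P := by
    rw [zero_add, hS.zero, hθ, hθ0, hexpand, smul_eq_mul, ← integral_const_mul]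
    congr 1
    ext o
    ring
  have hkm : MemLp (fun x : 𝒲 × Fin (d + 1) => (fun w a => h₀ w a - h w a) x.1 x.2) 2
    (P.map obsWA) := hh₀.memLp.sub hh.1
  have hk2 := memLp_obsWA (k := fun w a => h₀ w a - h w a) hkm
  have hstab : lpNorm (fun o => h₀ (obsW o) (obsA o) - h (obsW o) (obsA o)) 2 P ≤
      2 * C * (|ε| * B) * lpNorm (fun o => obsY o - h₀ (obsW o) (obsA o)) 2 P := by
    refine lpNorm_le_of_condExp_mul_eq_zero (m := MeasurableSpace.comap obsZA inferInstance)
      hC n1 hεC hk2 hr₀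
      (hbd _ hk2 (aestronglyMeasurable_obsWA (k := fun w a => h₀ w a - h w a) hkm.1)) (hgm ε) hg
      h02 ?_
    refine EventuallyEq.trans (EventuallyEq.of_eq ?_) hh.2
    congr 1
    ext o
    ring
  rw [hslope]
  refine (abs_integral_mul_sub_integral_mul_le
    (((hgm ε).sub_const 1).div_const ε).aestronglyMeasurable hsm iF iF₀ hη1' hgB).trans ?_
  have hdiff := integral_abs_bridgeIntegrand_sub_le hY hφ hh₀.memLp hh.1 a
  rw [mul_add]
  refine add_le_add le_rfl ?_
  have hqn : 0 ≤ 2 * lpNorm q 2 P := mul_nonneg zero_le_two lpNorm_nonneg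
  calc _ ≤ B * (2 * lpNorm q 2 P *
        (2 * C * (|ε| * B) * lpNorm (fun o => obsY o - h₀ (obsW o) (obsA o)) 2 P)) :=
        mul_le_mul_of_nonneg_left (hdiff.trans (mul_le_mul_of_nonneg_left hstab hqn)) hB
    _ = |ε| * K2 := by rw [hK2def]; ring
    _ ≤ η * K2 := mul_le_mul_of_nonneg_right hεη' hK2

end Pathwise

/-! ### Conditioning on an event -/

section Conditioning

variable {α : Type*} {m : MeasurableSpace α} [m0 : MeasurableSpace α] {μ : Measure α}

theorem setIntegral_inter_eq_setIntegral_condExp_mul [IsFiniteMeasure μ] (hm : m ≤ m0) {S C : Set α}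
    (hS : MeasurableSet S) (hC : MeasurableSet[m] C) {f : α → ℝ} (hf : Integrable f μ)
    (hfm : AEStronglyMeasurable[m] f μ) :
    ∫ x in C ∩ S, f x ∂μ = ∫ x in C, (μ⟦S | m⟧) x * f x ∂μ := by
  have hCm := hm C hC
  have h1 : AEStronglyMeasurable[m] (C.indicator f) μ :=
    ⟨C.indicator (hfm.mk f), hfm.stronglyMeasurable_mk.indicator hC, by
      filter_upwards [hfm.ae_eq_mk] with x hx
      simp only [Set.indicator, hx]⟩
  have e0 : (fun x => C.indicator f x * S.indicator (fun _ => (1 : ℝ)) x) =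
      (C ∩ S).indicator f := by
    ext x
    by_cases hx : x ∈ C <;> by_cases hx' : x ∈ S <;> simp [hx, hx']
  have h2 : Integrable (fun x => C.indicator f x * S.indicator (fun _ => (1 : ℝ)) x) μ := by
    rw [e0]
    exact hf.indicator (hCm.inter hS)
  have h3 := integral_mul_condExp hm h1 ((integrable_const (1 : ℝ)).indicator hS) h2
  rw [e0, integral_indicator (hCm.inter hS)] at h3
  rw [← h3, ← integral_indicator hCm]
  congr 1
  ext x
  by_cases hx : x ∈ C <;> simp [hx, mul_comm]

theorem setIntegral_cond {S C : Set α} (hC : MeasurableSet C) (f : α → ℝ) :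
    ∫ x in C, f x ∂μ[|S] = (μ.real S)⁻¹ * ∫ x in C ∩ S, f x ∂μ := by
  rw [ProbabilityTheory.cond, Measure.restrict_smul, Measure.restrict_restrict hC,
    integral_smul_measure, ENNReal.toReal_inv, smul_eq_mul]
  rfl

theorem ae_cond_of_ae {S : Set α} {p : α → Prop} (h : ∀ᵐ x ∂μ, p x) : ∀ᵐ x ∂μ[|S], p x :=
  cond_absolutelyContinuous.ae_le h

theorem MemLp.cond {f : α → ℝ} {p : ENNReal} (hf : MemLp f p μ) {S : Set α} (hS : μ S ≠ 0) :
    MemLp f p (μ[|S]) := by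
  rw [ProbabilityTheory.cond]
  exact (hf.restrict S).smul_measure (ENNReal.inv_ne_top.2 hS)

end Conditioning

/-! ### Identification of the dose-response -/

section Identification

variable {d : ℕ} {Ω 𝒲 𝒵 𝒰 : Type*} [MeasurableSpace Ω] [MeasurableSpace 𝒲] [MeasurableSpace 𝒵]
  [MeasurableSpace 𝒰] {μ : Measure Ω} {Y : Ω → ℝ} {A : Ω → Fin (d + 1)} {W : Ω → 𝒲} {Z : Ω → 𝒵}
  {U : Ω → 𝒰}

/-- Under completeness, functions of `U` that agree given `A = a` agree everywhere. -/
theorem IsProxyComplete.ae_eq (hcomplete : IsProxyComplete μ A Z U) (a : Fin (d + 1))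
    {f g : Ω → ℝ} (hf : StronglyMeasurable[MeasurableSpace.comap U inferInstance] f)
    (hg : StronglyMeasurable[MeasurableSpace.comap U inferInstance] g)
    (hfg : f =ᵐ[μ[|A ⁻¹' {a}]] g) : f =ᵐ[μ] g := by
  obtain ⟨f', hf', rfl⟩ := hf.exists_eq_measurable_comp
  obtain ⟨g', hg', rfl⟩ := hg.exists_eq_measurable_comp
  have hN : MeasurableSet {u | f' u ≠ g' u} :=
    (measurableSet_eq_fun hf'.measurable hg'.measurable).compl
  have hl : Measurable ({u | f' u ≠ g' u}.indicator fun _ => (1 : ℝ)) :=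
    measurable_const.indicator hN
  have h0 : (fun ω => {u | f' u ≠ g' u}.indicator (fun _ => (1 : ℝ)) (U ω))
      =ᵐ[μ[|A ⁻¹' {a}]] 0 := by
    filter_upwards [hfg] with ω hω
    have : U ω ∉ {u | f' u ≠ g' u} := fun h => h hω
    rw [Set.indicator_of_notMem this, Pi.zero_apply]
  have h1 := (hcomplete a _ hl ((memLp_congr_ae h0).2 MemLp.zero)).1
    ((condExp_congr_ae h0).trans (by rw [condExp_zero]))
  filter_upwards [h1] with ω hω
  by_contra hne
  have : U ω ∈ {u | f' u ≠ g' u} := hne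
  rw [Set.indicator_of_mem this] at hω
  exact one_ne_zero hω

variable [StandardBorelSpace Ω] [IsProbabilityMeasure μ]

/-- Conditioning on `A = a` does not change the conditional law of `W` given `U`. -/
theorem IsProxyModel.condExp_cond_ae_eq (hmodel : IsProxyModel μ Y A W Z U) {a : Fin (d + 1)}
    {H : Ω → ℝ} (hH : Integrable H μ)
    (hHW : AEStronglyMeasurable[MeasurableSpace.comap W inferInstance] H μ)
    (hS : μ (A ⁻¹' {a}) ≠ 0) :
    (μ[|A ⁻¹' {a}])[H | MeasurableSpace.comap U inferInstance] =ᵐ[μ[|A ⁻¹' {a}]]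
      μ[H | MeasurableSpace.comap U inferInstance] := by
  have hU := hmodel.measurable_U
  have hSm : MeasurableSet (A ⁻¹' {a}) := hmodel.measurable_A (measurableSet_singleton a)
  have hint : ∀ {f : Ω → ℝ}, Integrable f μ → Integrable f (μ[|A ⁻¹' {a}]) := fun hf =>
    memLp_one_iff_integrable.1 (MemLp.cond (memLp_one_iff_integrable.2 hf) hS)
  refine (ae_eq_condExp_of_forall_setIntegral_eq hU.comap_le (hint hH)
    (fun _ _ _ => (hint integrable_condExp).integrableOn) (fun C hC _ => ?_)
    stronglyMeasurable_condExp.aestronglyMeasurable).symm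
  have hCm := hU.comap_le C hC
  rw [setIntegral_cond hCm, setIntegral_cond hCm]
  congr 1
  -- Both integrals over `A = a` become integrals weighted by `P(A = a | U)`: for `H` by `W ⊥ A |
  -- U`, for `E[H | U]` because it is a function of `U`.
  rw [CondIndepFun.setIntegral_inter_preimage hmodel.indep_W_A hmodel.measurable_W
    hmodel.measurable_A hH hHW (measurableSet_singleton a) hC,
    setIntegral_inter_eq_setIntegral_condExp_mul hU.comap_le hSm hC integrable_condExp
      stronglyMeasurable_condExp.aestronglyMeasurable,
    ← setIntegral_condExp hU.comap_le (integrable_condExp_indicator_mul hU.comap_le hSm hH) hC]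
  refine setIntegral_congr_ae hCm ?_
  filter_upwards [condExp_mul_of_stronglyMeasurable_left (μ := μ)
    (stronglyMeasurable_condExp (m := MeasurableSpace.comap U inferInstance)
      (f := (A ⁻¹' {a}).indicator fun _ => (1 : ℝ)))
    (integrable_condExp_indicator_mul hU.comap_le hSm hH) hH] with ω hω _
  exact hω.symm

/-- The residual `Y - h(W, a)` of an outcome bridge function has conditional mean zero given `U` and
`A = a`, if `Z` is complete for `U`. -/
theorem IsProxyModel.condExp_residual_ae_eq_zero (hmodel : IsProxyModel μ Y A W Z U)
    (hcomplete : IsProxyComplete μ A Z U) {a : Fin (d + 1)} {H : Ω → ℝ} (hY : Integrable Y μ)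
    (hH : Integrable H μ)
    (hHW : AEStronglyMeasurable[MeasurableSpace.comap W inferInstance] H μ)
    (hS : μ (A ⁻¹' {a}) ≠ 0) (hF2 : MemLp (fun ω => Y ω - H ω) 2 (μ[|A ⁻¹' {a}]))
    (hF0 : ∀ B : Set 𝒵, MeasurableSet B → ∫ ω in A ⁻¹' {a} ∩ Z ⁻¹' B, (Y ω - H ω) ∂μ = 0) :
    (μ[|A ⁻¹' {a}])[fun ω => Y ω - H ω | MeasurableSpace.comap U inferInstance]
      =ᵐ[μ[|A ⁻¹' {a}]] 0 := by
  set S : Set Ω := A ⁻¹' {a} with hSdef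
  set F : Ω → ℝ := fun ω => Y ω - H ω with hFdef
  have hU := hmodel.measurable_U
  have hZ := hmodel.measurable_Z
  have hUA := hU.prodMk hmodel.measurable_A
  have hSm : MeasurableSet S := hmodel.measurable_A (measurableSet_singleton a)
  have hSG : MeasurableSet[MeasurableSpace.comap (fun ω => (U ω, A ω)) inferInstance] S :=
    ⟨Prod.snd ⁻¹' {a}, measurable_snd (measurableSet_singleton a), rfl⟩
  have hF : Integrable F μ := hY.sub hH
  have hprob : IsProbabilityMeasure (μ[|S]) := cond_isProbabilityMeasure hS
  obtain ⟨l, hl, hFl⟩ := (stronglyMeasurable_condExp (μ := μ[|S]) (f := F)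
    (m := MeasurableSpace.comap U inferInstance)).exists_eq_measurable_comp
  have hl2 : MemLp (fun ω => l (U ω)) 2 (μ[|S]) := by
    have h := hF2.condExp (m := MeasurableSpace.comap U inferInstance) one_le_two
    rw [hFl] at h
    exact h
  have hlS : IntegrableOn (fun ω => l (U ω)) S μ := by
    have h := hl2.integrable one_le_two
    rw [ProbabilityTheory.cond, integrable_smul_measure
      (ENNReal.inv_ne_zero.2 (measure_ne_top _ _)) (ENNReal.inv_ne_top.2 hS)] at h
    exact h
  -- Here `l(U) = E[F | U, A = a]`; once its conditional mean given `Z` is shown to vanish,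
  -- completeness yields `l(U) = 0`.
  have hlZ : (μ[|S])[fun ω => l (U ω) | MeasurableSpace.comap Z inferInstance] =ᵐ[μ[|S]] 0 := by
    rw [condExp_ae_eq_zero_iff hZ.comap_le (hl2.integrable one_le_two)]
    rintro _ ⟨B, hB, rfl⟩
    have hZB : MeasurableSet (Z ⁻¹' B) := hZ hB
    rw [setIntegral_cond hZB, Set.inter_comm]
    suffices ∫ ω in S ∩ Z ⁻¹' B, l (U ω) ∂μ = 0 by rw [this, mul_zero]
    have hp01 := condExp_indicator_mem_Icc (μ := μ)
      (m := MeasurableSpace.comap (fun ω => (U ω, A ω)) inferInstance) (Z ⁻¹' B) hZB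
    set p := μ⟦Z ⁻¹' B | MeasurableSpace.comap (fun ω => (U ω, A ω)) inferInstance⟧
    obtain ⟨β, hβ, hpβ⟩ := (stronglyMeasurable_condExp (μ := μ)
      (f := (Z ⁻¹' B).indicator fun _ => (1 : ℝ))
      (m := MeasurableSpace.comap (fun ω => (U ω, A ω)) inferInstance)).exists_eq_measurable_comp
    -- On `A = a` the conditional probability of `Z ∈ B` given `(U, A)` depends on `U` alone, so it
    -- can be paired with `E[F | U, A = a]`.
    have hpa : ∀ ω ∈ S, p ω = β (U ω, a) := by
      intro ω hω
      have hω' : A ω = a := hω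
      have := congrFun hpβ ω
      simpa [hω'] using this
    have hνS : ∀ᵐ ω ∂μ[|S], ω ∈ S := ae_cond_mem hSm
    have hβU : StronglyMeasurable[MeasurableSpace.comap U inferInstance]
        fun ω => β (U ω, a) :=
      (hβ.comp_measurable (measurable_id.prodMk measurable_const)).comp_measurable
        (comap_measurable U)
    have hβF : Integrable (fun ω => β (U ω, a) * F ω) (μ[|S]) := by
      refine (hF2.integrable one_le_two).bdd_mul (c := 1)
        (hβU.mono hU.comap_le).aestronglyMeasurable ?_
      filter_upwards [hνS, ae_cond_of_ae hp01] with ω h1 h2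
      rw [← hpa ω h1, Real.norm_eq_abs, abs_of_nonneg h2.1]
      exact h2.2
    have key := integral_mul_condExp hU.comap_le hβU.aestronglyMeasurable
      (hF2.integrable one_le_two) hβF
    rw [hFl, ← setIntegral_univ, ← setIntegral_univ (f := fun ω => β (U ω, a) * F ω),
      setIntegral_cond .univ, setIntegral_cond .univ, Set.univ_inter] at key
    have hc : (μ.real S)⁻¹ ≠ 0 := inv_ne_zero (ENNReal.toReal_ne_zero.2 ⟨hS, measure_ne_top _ _⟩)
    have key2 := mul_left_cancel₀ hc key
    have e1 : ∫ ω in S ∩ Z ⁻¹' B, l (U ω) ∂μ = ∫ ω in S, β (U ω, a) * l (U ω) ∂μ := by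
      have hf : Integrable (S.indicator fun ω => l (U ω)) μ := hlS.integrable_indicator hSm
      have hfm : StronglyMeasurable[MeasurableSpace.comap (fun ω => (U ω, A ω)) inferInstance]
          (S.indicator fun ω => l (U ω)) := by
        refine StronglyMeasurable.indicator ?_ hSG
        exact hl.comp_measurable (measurable_fst.comp (comap_measurable fun ω => (U ω, A ω)))
      have h := setIntegral_inter_eq_setIntegral_condExp_mul hUA.comap_le hZB hSG hf
        hfm.aestronglyMeasurable
      rw [setIntegral_congr_fun (g := fun ω => l (U ω)) (hSm.inter hZB)
        (fun ω hω => Set.indicator_of_mem hω.1 _)] at h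
      rw [h]
      refine setIntegral_congr_fun hSm fun ω hω => ?_
      rw [Set.indicator_of_mem hω]
      exact congrArg (· * l (U ω)) (hpa ω hω)
    -- `Y` and `H`, a function of `W`, are treated separately: only `Y ⊥ Z` and `W ⊥ Z` given `(U,
    -- A)` are assumed, not joint independence of `(Y, W)` from `Z`.
    have e2 : ∫ ω in S, β (U ω, a) * F ω ∂μ = ∫ ω in S ∩ Z ⁻¹' B, F ω ∂μ := by
      have hY' := CondIndepFun.setIntegral_inter_preimage hmodel.indep_Y_Z hmodel.measurable_Y
        hZ hY (comap_measurable Y).aestronglyMeasurable hB hSG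
      have hH' := CondIndepFun.setIntegral_inter_preimage hmodel.indep_W_Z hmodel.measurable_W
        hZ hH hHW hB hSG
      rw [integral_sub hY.integrableOn hH.integrableOn, hY', hH', ← integral_sub
        (integrable_condExp_indicator_mul hUA.comap_le hZB hY).integrableOn
        (integrable_condExp_indicator_mul hUA.comap_le hZB hH).integrableOn]
      refine setIntegral_congr_fun hSm fun ω hω => ?_
      simp only [hFdef]
      rw [← hpa ω hω]
      ring
    rw [e1]
    exact key2.trans (e2.trans (hF0 B hB))
  have h0 := (hcomplete a l hl.measurable hl2).1 hlZ
  rw [hFl]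
  exact ae_cond_of_ae h0

/-- Identification of the dose-response by an outcome bridge function. -/
theorem IsProxyModel.integrable_outcomeRegression_and_thetaATE_eq
    (hmodel : IsProxyModel μ Y A W Z U)
    (hcomplete : IsProxyComplete μ A Z U) {P : Measure (Obs d 𝒲 𝒵)}
    (hP : P = observedLaw μ Y A W Z) (hY : MemLp obsY 2 P) {φ : 𝒵 → Fin (d + 1) → ℝ}
    (hφ : IsTreatmentBridge P φ) {h : 𝒲 → Fin (d + 1) → ℝ} (hh : IsOutcomeBridge P h)
    (a : Fin (d + 1)) :
    Integrable (outcomeRegression μ Y A U a) μ ∧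
      ∫ o, h (obsW o) a ∂P = thetaATE μ Y A U a := by
  have hT : Measurable fun ω => ((Y ω, A ω, W ω, Z ω) : Obs d 𝒲 𝒵) :=
    hmodel.measurable_Y.prodMk (hmodel.measurable_A.prodMk
      (hmodel.measurable_W.prodMk hmodel.measurable_Z))
  unfold observedLaw at hP
  have hPp : IsProbabilityMeasure P := hP ▸ Measure.isProbabilityMeasure_map hT.aemeasurable
  have hSm : MeasurableSet (A ⁻¹' {a}) := hmodel.measurable_A (measurableSet_singleton a)
  have hac := hφ.overlap a
  have hS : μ (A ⁻¹' {a}) ≠ 0 := by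
    have := pA_ne_zero_of_ac hac
    rwa [hP, Measure.map_apply hT (measurableSet_obsA_preimage a)] at this
  have hYμ : MemLp Y 2 μ := by
    rw [hP] at hY
    exact hY.comp_of_map hT.aemeasurable
  have hhWA : MemLp (fun ω => h (W ω) (A ω)) 2 μ := by
    have := memLp_obsWA hh.memLp
    rw [hP] at this
    exact this.comp_of_map hT.aemeasurable
  have hi := (hφ.integrable_and_integral_eq hh.memLp a).1
  have hPW : P.map obsW = μ.map W := by
    rw [hP, Measure.map_map measurable_obsW hT]
    rfl
  have hsec : AEStronglyMeasurable (fun w => h w a) (μ.map W) :=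
    hPW ▸ (aestronglyMeasurable_section hh.memLp.1 a).mono_ac hac
  have hHint : Integrable (fun ω => h (W ω) a) μ := by
    rw [hP] at hi
    exact hi.comp_measurable hT
  have hHW : AEStronglyMeasurable[MeasurableSpace.comap W inferInstance]
      (fun ω => h (W ω) a) μ := hsec.comp_ae_measurable' hmodel.measurable_W.aemeasurable
  have hF2 : MemLp (fun ω => Y ω - h (W ω) a) 2 (μ[|A ⁻¹' {a}]) := by
    refine (memLp_congr_ae ?_).1 (MemLp.cond (hYμ.sub hhWA) hS)
    filter_upwards [ae_cond_mem hSm] with ω hω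
    have hω' : A ω = a := hω
    simp [hω']
  have hF0 : ∀ B : Set 𝒵, MeasurableSet B →
      ∫ ω in A ⁻¹' {a} ∩ Z ⁻¹' B, (Y ω - h (W ω) a) ∂μ = 0 := by
    intro B hB
    have hr : Integrable (fun o => obsY o - h (obsW o) (obsA o)) P :=
      (hY.sub (memLp_obsWA hh.memLp)).integrable one_le_two
    have hBa : MeasurableSet (B ×ˢ ({a} : Set (Fin (d + 1)))) :=
      hB.prod (measurableSet_singleton a)
    have h0 := (condExp_ae_eq_zero_iff measurable_obsZA.comap_le hr).1
      ((isOutcomeBridge_iff hY).1 hh).2 _ ⟨_, hBa, rfl⟩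
    rw [hP] at h0 hr
    rw [setIntegral_map (measurable_obsZA hBa) hr.1 hT.aemeasurable] at h0
    rw [← h0]
    have hset : (fun ω => ((Y ω, A ω, W ω, Z ω) : Obs d 𝒲 𝒵)) ⁻¹'
        (obsZA ⁻¹' (B ×ˢ ({a} : Set (Fin (d + 1))))) = A ⁻¹' {a} ∩ Z ⁻¹' B := by
      ext ω
      simp [obsZA, obsZ, obsA, and_comm]
    rw [hset]
    refine setIntegral_congr_fun (hSm.inter (hmodel.measurable_Z hB)) fun ω hω => ?_
    have hω' : A ω = a := hω.1
    simp [obsY, obsW, obsA, hω']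
  have hres := hmodel.condExp_residual_ae_eq_zero hcomplete (hYμ.integrable one_le_two) hHint hHW
    hS hF2 hF0
  have hcond := hmodel.condExp_cond_ae_eq hHint hHW hS
  have hint : ∀ {f : Ω → ℝ}, Integrable f μ → Integrable f (μ[|A ⁻¹' {a}]) := fun hf =>
    memLp_one_iff_integrable.1 (MemLp.cond (memLp_one_iff_integrable.2 hf) hS)
  have hsub := condExp_sub (hint (hYμ.integrable one_le_two)) (hint hHint)
    (MeasurableSpace.comap U inferInstance)
  have hae : outcomeRegression μ Y A U a =ᵐ[μ]
      μ[fun ω => h (W ω) a | MeasurableSpace.comap U inferInstance] := by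
    refine hcomplete.ae_eq a stronglyMeasurable_condExp stronglyMeasurable_condExp ?_
    filter_upwards [hres, hcond, hsub] with ω h1 h2 h3
    have h4 := h3.symm.trans h1
    rw [Pi.sub_apply, Pi.zero_apply, sub_eq_zero] at h4
    exact h4.trans h2
  refine ⟨integrable_condExp.congr hae.symm, ?_⟩
  rw [thetaATE, integral_congr_ae hae, integral_condExp hmodel.measurable_U.comap_le]
  have h5 := hi.1
  rw [hP] at h5 ⊢
  rw [integral_map hT.aemeasurable h5]
  rfl

end Identification

/-! ### Tangent space, uniqueness and the efficiency bound -/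

section EfficiencyTheory

variable {O : Type*} [MeasurableSpace O] {P : Measure O}

theorem inner_toLp_eq_integral {f g : O → ℝ} (hf : MemLp f 2 P) {g' : Lp ℝ 2 P} (hg : g' =ᵐ[P] g) :
    inner ℝ (hf.toLp f) g' = ∫ o, f o * g o ∂P := by
  rw [L2.inner_def]
  refine integral_congr_ae ?_
  filter_upwards [hf.coeFn_toLp, hg] with o h1 h2
  rw [h1, h2]
  simp [mul_comm]

theorem norm_sq_eq_integral {g : O → ℝ} {g' : Lp ℝ 2 P} (hg : g' =ᵐ[P] g) :
    ‖g'‖ ^ 2 = ∫ o, g o ^ 2 ∂P := by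
  rw [← real_inner_self_eq_norm_sq, L2.inner_def]
  refine integral_congr_ae ?_
  filter_upwards [hg] with o h1
  rw [h1]
  simp [pow_two]

/-- Bounded measurable functions of mean zero are dense in the square integrable functions of mean
zero. -/
theorem mem_closure_bounded_mean_zero [IsProbabilityMeasure P] {ψ : O → ℝ} (hψ : MemLp ψ 2 P)
    (h0 : ∫ o, ψ o ∂P = 0) :
    hψ.toLp ψ ∈ closure {f : Lp ℝ 2 P | ∃ s : O → ℝ, Measurable s ∧ MemLp s ⊤ P ∧
      ∫ o, s o ∂P = 0 ∧ f =ᵐ[P] s} := by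
  rw [Metric.mem_closure_iff]
  intro e he
  obtain ⟨f, hf, hf2⟩ := hψ.exists_simpleFunc_eLpNorm_sub_lt (ε := ENNReal.ofReal (e / 2)) (by simp)
    (ENNReal.ofReal_pos.2 (half_pos he)).ne'
  -- Centring the simple function costs at most the approximation error again, because `ψ` has mean
  -- zero; hence the tolerance `e / 2`.
  set c := ∫ o, f o ∂P with hc
  have hf_bdd : MemLp f ⊤ P := f.memLp_top P
  have hs_bdd : MemLp (fun o => f o - c) ⊤ P := hf_bdd.sub (memLp_const c)
  have hs2 : MemLp (fun o => f o - c) 2 P := hf2.sub (memLp_const c)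
  refine ⟨hs2.toLp _, ⟨fun o => f o - c, f.measurable.sub_const c, hs_bdd, ?_, hs2.coeFn_toLp⟩, ?_⟩
  · rw [integral_sub (hf2.integrable one_le_two) (integrable_const c)]
    simp [hc]
  · have hd : MemLp (ψ - ⇑f) 2 P := hψ.sub hf2
    have h1 : lpNorm (ψ - ⇑f) 2 P < e / 2 := by
      rw [← toReal_eLpNorm hd.1]
      have := (ENNReal.toReal_lt_toReal hd.2.ne ENNReal.ofReal_ne_top).2 hf
      rwa [ENNReal.toReal_ofReal (half_pos he).le] at this
    have h2 : |c| ≤ lpNorm (ψ - ⇑f) 2 P := by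
      have h := integral_mul_le_lpNorm_mul_lpNorm hd (memLp_const (1 : ℝ))
      have hone : lpNorm (fun _ : O => (1 : ℝ)) 2 P = 1 := by
        rw [lpNorm_const (by simp) (IsProbabilityMeasure.ne_zero P)]
        simp
      rw [hone, mul_one] at h
      simp only [mul_one, Pi.sub_apply] at h
      rwa [integral_sub (hψ.integrable one_le_two) (hf2.integrable one_le_two), h0, zero_sub,
        abs_neg] at h
    have h3 : ψ - (fun o => f o - c) = (ψ - ⇑f) + fun _ => c := by
      ext o
      simp only [Pi.sub_apply, Pi.add_apply]
      ring
    have hcn : lpNorm (fun _ : O => c) 2 P = |c| := by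
      rw [lpNorm_const (by simp) (IsProbabilityMeasure.ne_zero P)]
      simp
    rw [dist_eq_norm, ← MemLp.toLp_sub, Lp.norm_toLp, toReal_eLpNorm (hψ.sub hs2).1, h3]
    calc _ ≤ lpNorm (ψ - ⇑f) 2 P + lpNorm (fun _ : O => c) 2 P := lpNorm_add_le hd one_le_two
      _ < e := by rw [hcn]; linarith

variable {M : Set (Measure O)} {θ : Measure O → ℝ}

theorem mem_tangentSpace_of_forall_score [IsProbabilityMeasure P]
    (hM : ∀ s : O → ℝ, Measurable s → MemLp s ⊤ P → ∫ o, s o ∂P = 0 →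
      ∃ Q, IsSmoothSubmodel M P Q s) {ψ : O → ℝ} (hψ : MemLp ψ 2 P) (h0 : ∫ o, ψ o ∂P = 0) :
    hψ.toLp ψ ∈ tangentSpace M P := by
  refine closure_mono ?_ (mem_closure_bounded_mean_zero hψ h0)
  rintro f ⟨s, hsm, hs, hs0, hfs⟩
  obtain ⟨Q, hQ⟩ := hM s hsm hs hs0
  exact Submodule.subset_span ⟨Q, s, hQ, hfs⟩

/-- Efficient influence functions are almost surely unique. -/
theorem IsEfficientInfluenceFunction.ae_eq {ψ ψ' : O → ℝ}
    (h : IsEfficientInfluenceFunction M θ P ψ) (h' : IsEfficientInfluenceFunction M θ P ψ') :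
    ψ =ᵐ[P] ψ' := by
  set v := h.memLp.toLp ψ - h'.memLp.toLp ψ' with hv
  have hmem : v ∈ tangentSpace M P := Submodule.sub_mem _ h.mem_tangent h'.mem_tangent
  -- Both functions represent the same derivative along every submodel, so `v` is orthogonal to all
  -- scores and hence to the tangent space, in which it lies.
  have horth : tangentSpace M P ≤ (Submodule.span ℝ {v})ᗮ := by
    refine Submodule.topologicalClosure_minimal _ ?_ (Submodule.isClosed_orthogonal _)
    rw [Submodule.span_le]
    rintro f ⟨Q, s, hQ, hfs⟩
    rw [SetLike.mem_coe, Submodule.mem_orthogonal_singleton_iff_inner_right, hv, inner_sub_left,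
      inner_toLp_eq_integral h.memLp hfs, inner_toLp_eq_integral h'.memLp hfs,
      (h.pathwise Q s hQ).unique (h'.pathwise Q s hQ), sub_self]
  have hvv := Submodule.mem_orthogonal_singleton_iff_inner_right.1 (horth hmem)
  rw [inner_self_eq_zero, hv, sub_eq_zero] at hvv
  exact (MemLp.toLp_eq_toLp_iff h.memLp h'.memLp).1 hvv

/-- If all bounded mean-zero functions are scores, then the efficiency bound is the variance of the
efficient influence function. -/
theorem IsEfficientInfluenceFunction.isEfficiencyBound [IsProbabilityMeasure P] {ψ : O → ℝ}
    (h : IsEfficientInfluenceFunction M θ P ψ)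
    (hM : ∀ s : O → ℝ, Measurable s → MemLp s ⊤ P → ∫ o, s o ∂P = 0 →
      ∃ Q, IsSmoothSubmodel M P Q s) :
    IsEfficiencyBound M θ P (∫ o, ψ o ^ 2 ∂P) := by
  set x := h.memLp.toLp ψ with hx
  have hxn : ∫ o, ψ o ^ 2 ∂P = ‖x‖ ^ 2 := (norm_sq_eq_integral h.memLp.coeFn_toLp).symm
  rw [hxn]
  constructor
  · rintro v ⟨Q, s, D, hQ, hD, rfl⟩
    have hs2 : MemLp s 2 P := hQ.score_bdd.mono_exponent le_top
    rw [hD.unique (h.pathwise Q s hQ), ← inner_toLp_eq_integral h.memLp hs2.coeFn_toLp,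
      ← norm_sq_eq_integral hs2.coeFn_toLp]
    -- This form of the division bound also covers a score with zero norm, where the quotient is
    -- `0`.
    refine div_le_of_le_mul₀ (sq_nonneg _) (sq_nonneg _) ?_
    rw [← mul_pow, ← sq_abs]
    exact pow_le_pow_left₀ (abs_nonneg _) (abs_real_inner_le_norm _ _) 2
  · intro b hb
    have hmem : ∀ f : Lp ℝ 2 P, (∃ s : O → ℝ, Measurable s ∧ MemLp s ⊤ P ∧
        ∫ o, s o ∂P = 0 ∧ f =ᵐ[P] s) → inner ℝ x f ^ 2 / ‖f‖ ^ 2 ≤ b := by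
      rintro f ⟨s, hsm, hs, hs0, hfs⟩
      obtain ⟨Q, hQ⟩ := hM s hsm hs hs0
      exact hb ⟨Q, s, _, hQ, h.pathwise Q s hQ, by
        rw [inner_toLp_eq_integral h.memLp hfs, norm_sq_eq_integral hfs]⟩
    by_cases hx0 : x = 0
    · have := hmem 0 ⟨0, measurable_zero, MemLp.zero, by simp, Lp.coeFn_zero _ _ _⟩
      simpa [hx0] using this
    -- The influence function need not be bounded, so it need not be a score; the bound is
    -- approached along bounded scores converging to it in `L²`.
    · obtain ⟨u, hu, hux⟩ := mem_closure_iff_seq_limit.1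
        (mem_closure_bounded_mean_zero h.memLp h.mean_zero)
      have hn : ‖x‖ ^ 2 ≠ 0 := pow_ne_zero 2 (norm_ne_zero_iff.2 hx0)
      have hlim : Tendsto (fun n => inner ℝ x (u n) ^ 2 / ‖u n‖ ^ 2) atTop
          (𝓝 (inner ℝ x x ^ 2 / ‖x‖ ^ 2)) :=
        ((tendsto_const_nhds.inner hux).pow 2).div (hux.norm.pow 2) hn
      have hval : inner ℝ x x ^ 2 / ‖x‖ ^ 2 = ‖x‖ ^ 2 := by
        rw [real_inner_self_eq_norm_sq]
        field_simp
      rw [hval] at hlim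
      exact le_of_tendsto' hlim fun n => hmem _ (hu n)

end EfficiencyTheory

/-! ### Square integrability and mean of the influence function -/

section InfluenceFunction

variable {d : ℕ} {𝒲 𝒵 : Type*} [MeasurableSpace 𝒲] [MeasurableSpace 𝒵]
  {P : Measure (Obs d 𝒲 𝒵)}

theorem memLp_bridgeWeight_mul_residual {h₀ : 𝒲 → Fin (d + 1) → ℝ} {φ : 𝒵 → Fin (d + 1) → ℝ}
    {a : Fin (d + 1)}
    (hres : MemLp (fun o => φ (obsZ o) (obsA o) * (obsY o - h₀ (obsW o) (obsA o)) *
      (if obsA o = a then 1 else 0)) 2 P) :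
    MemLp (fun o => bridgeWeight P φ a o * (obsY o - h₀ (obsW o) (obsA o))) 2 P := by
  refine (memLp_congr_ae (ae_of_all _ fun o => ?_)).1 (hres.const_mul (1 / pA P a))
  by_cases ho : obsA o = a
  · simp only [bridgeWeight, ho, if_true]
    ring
  · simp [bridgeWeight, ho]

theorem psiATE_eq (h₀ : 𝒲 → Fin (d + 1) → ℝ) (φ : 𝒵 → Fin (d + 1) → ℝ) (θ : ℝ)
    (a : Fin (d + 1)) :
    psiATE P h₀ φ θ a = fun o =>
      bridgeWeight P φ a o * (obsY o - h₀ (obsW o) (obsA o)) + h₀ (obsW o) a - θ := by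
  ext o
  simp only [psiATE, bridgeWeight]
  ring

variable [IsProbabilityMeasure P]

theorem memLp_psiATE {h₀ : 𝒲 → Fin (d + 1) → ℝ} {φ : 𝒵 → Fin (d + 1) → ℝ} {a : Fin (d + 1)}
    (hh₀a : MemLp (fun o => h₀ (obsW o) a) 2 P)
    (hres : MemLp (fun o => φ (obsZ o) (obsA o) * (obsY o - h₀ (obsW o) (obsA o)) *
      (if obsA o = a then 1 else 0)) 2 P) (θ : ℝ) : MemLp (psiATE P h₀ φ θ a) 2 P := by
  rw [psiATE_eq]
  exact ((memLp_bridgeWeight_mul_residual hres).add hh₀a).sub (memLp_const θ)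

theorem integral_psiATE_eq_zero (hY : MemLp obsY 2 P) {h₀ : 𝒲 → Fin (d + 1) → ℝ}
    (hh₀ : IsOutcomeBridge P h₀) {φ : 𝒵 → Fin (d + 1) → ℝ} (hφ : IsTreatmentBridge P φ)
    (a : Fin (d + 1)) : ∫ o, psiATE P h₀ φ (∫ o, h₀ (obsW o) a ∂P) a o ∂P = 0 := by
  have hr : MemLp (fun o => obsY o - h₀ (obsW o) (obsA o)) 2 P := hY.sub (memLp_obsWA hh₀.memLp)
  have hqr : Integrable (fun o => bridgeWeight P φ a o * (obsY o - h₀ (obsW o) (obsA o))) P :=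
    (hφ.memLp_bridgeWeight a).integrable_mul hr
  have hh := (hφ.integrable_and_integral_eq hh₀.memLp a).1
  have hsum : Integrable (fun o => bridgeWeight P φ a o * (obsY o - h₀ (obsW o) (obsA o)) +
    h₀ (obsW o) a) P := hqr.add hh
  rw [psiATE_eq, integral_sub hsum (integrable_const _), integral_add hqr hh,
    hφ.integral_bridgeWeight_mul_eq_zero a (hr.integrable one_le_two) hqr
      ((isOutcomeBridge_iff hY).1 hh₀).2]
  simp

end InfluenceFunction

end

/-! ### The efficient influence function and the efficiency bound -/

theorem mainTheorem2 {d : ℕ} {Ω 𝒲 𝒵 𝒰 : Type*}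
    [MeasurableSpace Ω] [StandardBorelSpace Ω] [MeasurableSpace 𝒲] [MeasurableSpace 𝒵]
    [MeasurableSpace 𝒰] (μ : Measure Ω) [IsProbabilityMeasure μ]
    (Y : Ω → ℝ) (A : Ω → Fin (d + 1)) (W : Ω → 𝒲) (Z : Ω → 𝒵) (U : Ω → 𝒰)
    (hmodel : IsProxyModel μ Y A W Z U)
    (hcomplete : IsProxyComplete μ A Z U)
    (P : Measure (Obs d 𝒲 𝒵)) (hP : P = observedLaw μ Y A W Z)
    (hY : MemLp obsY 2 P)
    (hT : CondExpSurjective P obsWA obsZA)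
    (hTstar : CondExpSurjective P obsZA obsWA)
    (h₀ : 𝒲 → Fin (d + 1) → ℝ) (hh₀ : IsOutcomeBridge P h₀)
    (φ₀ : 𝒵 → Fin (d + 1) → ℝ) (hφ₀ : IsTreatmentBridge P φ₀)
    (a : Fin (d + 1))
    (hh₀a : MemLp (fun o => h₀ (obsW o) a) 2 P)
    (hres : MemLp (fun o => φ₀ (obsZ o) (obsA o) * (obsY o - h₀ (obsW o) (obsA o)) *
      (if obsA o = a then 1 else 0)) 2 P) :
    (Integrable (outcomeRegression μ Y A U a) μ ∧
      IsBridgeValue a P (thetaATE μ Y A U a)) ∧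
    (IsEfficientInfluenceFunction (bridgeModel d 𝒲 𝒵 a) (doseResponseFunctional a) P
        (psiATE P h₀ φ₀ (thetaATE μ Y A U a) a) ∧
      ∀ ψ, IsEfficientInfluenceFunction (bridgeModel d 𝒲 𝒵 a) (doseResponseFunctional a) P ψ →
        ψ =ᵐ[P] psiATE P h₀ φ₀ (thetaATE μ Y A U a) a) ∧
    IsEfficiencyBound (bridgeModel d 𝒲 𝒵 a) (doseResponseFunctional a) P
      (∫ o, psiATE P h₀ φ₀ (thetaATE μ Y A U a) a o ^ 2 ∂P) := by
  have hT' : Measurable fun ω => ((Y ω, A ω, W ω, Z ω) : Obs d 𝒲 𝒵) :=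
    hmodel.measurable_Y.prodMk (hmodel.measurable_A.prodMk
      (hmodel.measurable_W.prodMk hmodel.measurable_Z))
  have hPp : IsProbabilityMeasure P := by
    rw [hP, observedLaw]
    exact Measure.isProbabilityMeasure_map hT'.aemeasurable
  have hid := fun h (hh : IsOutcomeBridge P h) =>
    hmodel.integrable_outcomeRegression_and_thetaATE_eq hcomplete hP hY hφ₀ hh a
  -- Identification applies to every outcome bridge function, so the value does not depend on the
  -- choice.
  have hval : IsBridgeValue a P (thetaATE μ Y A U a) :=
    ⟨⟨h₀, hh₀⟩, fun h hh => ⟨(hφ₀.integrable_and_integral_eq hh.memLp a).1, (hid h hh).2⟩⟩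
  have hscore : ∀ s : Obs d 𝒲 𝒵 → ℝ, Measurable s → MemLp s ⊤ P → ∫ o, s o ∂P = 0 →
      ∃ Q, IsSmoothSubmodel (bridgeModel d 𝒲 𝒵 a) P Q s := fun s hsm hs hs0 =>
    ⟨_, isSmoothSubmodel_tilt hY hT hTstar hφ₀ hsm hs hs0 a⟩
  have hmean : ∫ o, psiATE P h₀ φ₀ (thetaATE μ Y A U a) a o ∂P = 0 := by
    rw [← (hid h₀ hh₀).2]
    exact integral_psiATE_eq_zero hY hh₀ hφ₀ a
  have hEIF : IsEfficientInfluenceFunction (bridgeModel d 𝒲 𝒵 a) (doseResponseFunctional a) P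
      (psiATE P h₀ φ₀ (thetaATE μ Y A U a) a) :=
    { mem_model := ⟨hPp, hY, _, hval⟩
      memLp := memLp_psiATE hh₀a hres _
      mean_zero := hmean
      pathwise := fun Q s hS => hS.hasDerivAt_doseResponse hY hT hTstar hh₀ hφ₀ _
      mem_tangent := mem_tangentSpace_of_forall_score hscore _ hmean }
  exact ⟨⟨(hid h₀ hh₀).1, hval⟩, ⟨hEIF, fun ψ hψ => hψ.ae_eq hEIF⟩, hEIF.isEfficiencyBound hscore⟩
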